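/- Let $d\ge 1$. A finite set $\Delta\subseteq\mathbb{N}^d$ is a \emph{standard set} if its complement $C=\mathbb{N}^d\setminus\Delta$ satisfies $C+\mathbb{N}^d=C$. For $\gamma\in\mathbb{N}^{d-1}$ the \emph{height} of $\Delta$ over $\gamma$ is the number $h_\Delta(\gamma)$ of points of $\Delta$ whose first $d-1$ coordinates form $\gamma$. The \emph{Connect Four sum} of finite standard sets $\Delta_1,\dots,\Delta_h\subseteq\mathbb{N}^d$ is the set of all $\beta=(\gamma,b)\in\mathbb{N}^{d-1}\times\mathbb{N}$ with $b<h_{\Delta_1}(\gamma)+\dots+h_{\Delta_h}(\gamma)$. A \emph{Connect Four decomposition} of $\Delta\subseteq\mathbb{N}^d$ is a finite multiset of nonempty finite standard sets in $\mathbb{N}^{d-1}$ whose Connect Four sum is $\Delta$, where $\mathbb{N}^{d-1}$ is embedded into $\mathbb{N}^d$ by $\gamma\mapsto(\gamma,0)$. A standard set is specified by the list, in any order, of its \emph{outer corners}, i.e. of the minimal elements of its complement, each given by its coordinates. The set of all Connect Four decompositions of $\Delta$ is specified by a list of all standard sets that occur in them (each once, given by its outer corners), followed by a list with one entry per decomposition,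 namely the list, with multiplicity, of the positions of its members in the first list. \textbf{Theorem.} All Connect Four decompositions of a finite standard set can be generated in polynomial time, that is, in polynomial time in the combined size of input and output: there are a single program $P$ and a polynomial $p$ such that for every $d\ge1$, every finite standard set $\Delta\subseteq\mathbb{N}^d$ and every list of its outer corners, $P$ started on that list outputs a specification of the set of all Connect Four decompositions of $\Delta$ after at most $p(s_{\mathrm{in}}+s_{\mathrm{out}})$ steps, where $s_{\mathrm{in}}$ and $s_{\mathrm{out}}$ are the sizes of input and output. Here each natural number takes one word, and lists are represented by S-expressions (nested pairs with natural numbers as atoms), whose size is the number of their atoms and pairs. Programs are finite systems of first-order recursive function definitions over S-expressions (pure LISP), evaluated call-by-value; the primitive operations are constants, pairing, the two projections, addition and truncated subtraction of natural numbers, branching on whether a value is the atom $0$, local definitions and function calls, and each evaluation step takes unit time. -/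

import Mathlib

open scoped Pointwise

namespace ConnectFour

/-! ### Standard sets and Connect Four decompositions -/

/-- A standard set (staircase) in `ℕ^d`: a set whose complement `C` satisfies `C + ℕ^d = C`.
All standard sets under consideration are finite. -/
def IsStandard {d : ℕ} (Δ : Finset (Fin d → ℕ)) : Prop :=
  ((Δ : Set (Fin d → ℕ))ᶜ) + Set.univ = (Δ : Set (Fin d → ℕ))ᶜ

theorem isStandard_iff_isLowerSet {d : ℕ} (Δ : Finset (Fin d → ℕ)) :
    IsStandard Δ ↔ IsLowerSet (Δ : Set (Fin d → ℕ)) := by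
  rw [← isUpperSet_compl]
  constructor
  · intro h a b hab ha
    rw [← h]
    exact Set.mem_add.2 ⟨a, ha, b - a, Set.mem_univ _, add_tsub_cancel_of_le hab⟩
  · intro h
    ext b
    constructor
    · rintro ⟨a, ha, c, -, rfl⟩
      exact h (le_self_add) ha
    · intro hb
      exact ⟨b, hb, 0, Set.mem_univ _, add_zero b⟩

/-- The height of `Δ ⊆ ℕ^(d+1)` over `γ ∈ ℕ^d`: the cardinality of the fibre over `γ` of the
projection to the first `d` coordinates. -/
def height {d : ℕ} (Δ : Finset (Fin (d + 1) → ℕ)) (γ : Fin d → ℕ) : ℕ :=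
  (Δ.filter fun β => (fun i : Fin d => β i.castSucc) = γ).card

/-- The Connect Four sum of a multiset of finite standard sets in `ℕ^(d+1)`: the points whose last
coordinate is less than the sum of the heights over their projection. -/
def c4Sum {d : ℕ} (M : Multiset (Finset (Fin (d + 1) → ℕ))) : Set (Fin (d + 1) → ℕ) :=
  {β | β (Fin.last d) < (M.map fun Δ => height Δ fun i : Fin d => β i.castSucc).sum}

/-- The image of a subset of `ℕ^d` under the embedding `γ ↦ (γ, 0)` into `ℕ^(d+1)`. -/
def embed {d : ℕ} (Γ : Finset (Fin d → ℕ)) : Finset (Fin (d + 1) → ℕ) :=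
  Γ.image fun γ => Fin.snoc (α := fun _ => ℕ) γ 0

/-- A C4 decomposition of `Δ ⊆ ℕ^(d+1)`: a multiset of nonempty finite standard sets in `ℕ^d`
whose Connect Four sum is `Δ`. -/
def IsC4Decomposition {d : ℕ} (Δ : Finset (Fin (d + 1) → ℕ))
    (M : Multiset (Finset (Fin d → ℕ))) : Prop :=
  (∀ Γ ∈ M, IsStandard Γ ∧ Γ.Nonempty) ∧ c4Sum (M.map embed) = (Δ : Set (Fin (d + 1) → ℕ))

/-! ### Representation of the input and of the output -/

/-- An outer corner of `Δ`: a minimal element (that is, a minimal generator) of `ℕ^d \ Δ`. -/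
def IsOuterCorner {d : ℕ} (Δ : Finset (Fin d → ℕ)) (α : Fin d → ℕ) : Prop :=
  Minimal (fun β => β ∉ Δ) α

/-- `C` lists the outer corners of `Δ`, in some order and without repetition, each corner being
written as the list of its coordinates. -/
def IsCornerList {d : ℕ} (Δ : Finset (Fin d → ℕ)) (C : List (List ℕ)) : Prop :=
  ∃ A : List (Fin d → ℕ), A.Nodup ∧ (∀ α, α ∈ A ↔ IsOuterCorner Δ α) ∧ C = A.map List.ofFn

/-- The pair `(S, D)` specifies the set of all C4 decompositions of `Δ`. Here `S` is the list of
all standard sets that occur in some C4 decomposition, each exactly once and given by its outer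
corners; and `D` has one entry for each C4 decomposition, namely the list (with multiplicity, in
some order) of the positions in `S` of its members. -/
def IsListOfC4Decompositions {d : ℕ} (Δ : Finset (Fin (d + 1) → ℕ))
    (S : List (List (List ℕ))) (D : List (List ℕ)) : Prop :=
  ∃ (T : List (Finset (Fin d → ℕ))) (E : List (Multiset (Finset (Fin d → ℕ)))),
    T.Nodup ∧ (∀ Γ, Γ ∈ T ↔ ∃ M, IsC4Decomposition Δ M ∧ Γ ∈ M) ∧
    List.Forall₂ IsCornerList T S ∧
    E.Nodup ∧ (∀ M, M ∈ E ↔ IsC4Decomposition Δ M) ∧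
    List.Forall₂ (fun M l => M.map some = (Multiset.ofList l).map fun i => T[i]?) E D

/-! ### The model of computation

First-order recursive programs over S-expressions (pure LISP). The atoms are natural numbers, each
of which takes one word; the operations are pairing, the two projections, addition and truncated
subtraction of atoms, a test for zero, local definitions and calls of the finitely many functions
of the program. Evaluation is call-by-value and every evaluation step costs one unit of time. -/

/-- S-expressions with natural numbers as atoms. -/
inductive Val : Type
  | num : ℕ → Val
  | pair : Val → Val → Val

/-- The size of an S-expression: the number of its atoms and pairs. -/
def Val.size : Val → ℕ
  | .num _ => 1
  | .pair a b => 1 + a.size + b.size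

/-- A list as an S-expression; the empty list is the atom `0`. -/
def Val.ofList {α : Type} (f : α → Val) : List α → Val
  | [] => .num 0
  | a :: l => .pair (f a) (Val.ofList f l)

/-- Expressions. Variables are referred to by their position in the environment, functions by
their position in the program. Each function has one argument, which may be a tuple. -/
inductive Expr : Type
  | var : ℕ → Expr
  | const : ℕ → Expr
  | cons : Expr → Expr → Expr
  | head : Expr → Expr
  | tail : Expr → Expr
  | add : Expr → Expr → Expr
  | sub : Expr → Expr → Expr
  | cond : Expr → Expr → Expr → Expr
  | letIn : Expr → Expr → Expr
  | call : ℕ → Expr → Expr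

/-- A program is the finite list of the bodies of its functions. -/
abbrev Program : Type := List Expr

/-- `Eval P env e v t`: with the functions of `P` and the environment `env`, the expression `e`
evaluates to `v` in exactly `t` steps. -/
inductive Eval (P : Program) : List Val → Expr → Val → ℕ → Prop
  | var {env : List Val} {i : ℕ} {v : Val} :
      env[i]? = some v → Eval P env (.var i) v 1
  | const {env : List Val} {n : ℕ} :
      Eval P env (.const n) (.num n) 1
  | cons {env : List Val} {a b : Expr} {v w : Val} {s t : ℕ} :
      Eval P env a v s → Eval P env b w t → Eval P env (.cons a b) (.pair v w) (s + t + 1)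
  | head {env : List Val} {a : Expr} {v w : Val} {s : ℕ} :
      Eval P env a (.pair v w) s → Eval P env (.head a) v (s + 1)
  | tail {env : List Val} {a : Expr} {v w : Val} {s : ℕ} :
      Eval P env a (.pair v w) s → Eval P env (.tail a) w (s + 1)
  | add {env : List Val} {a b : Expr} {m n s t : ℕ} :
      Eval P env a (.num m) s → Eval P env b (.num n) t →
      Eval P env (.add a b) (.num (m + n)) (s + t + 1)
  | sub {env : List Val} {a b : Expr} {m n s t : ℕ} :
      Eval P env a (.num m) s → Eval P env b (.num n) t →
      Eval P env (.sub a b) (.num (m - n)) (s + t + 1)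
  | condTrue {env : List Val} {c a b : Expr} {u v : Val} {s t : ℕ} :
      Eval P env c u s → u ≠ .num 0 → Eval P env a v t → Eval P env (.cond c a b) v (s + t + 1)
  | condFalse {env : List Val} {c a b : Expr} {v : Val} {s t : ℕ} :
      Eval P env c (.num 0) s → Eval P env b v t → Eval P env (.cond c a b) v (s + t + 1)
  | letIn {env : List Val} {a b : Expr} {v w : Val} {s t : ℕ} :
      Eval P env a v s → Eval P (v :: env) b w t → Eval P env (.letIn a b) w (s + t + 1)
  | call {env : List Val} {f : ℕ} {a body : Expr} {v w : Val} {s t : ℕ} :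
      Eval P env a v s → P[f]? = some body → Eval P [v] body w t →
      Eval P env (.call f a) w (s + t + 1)

/-- Evaluation is deterministic. -/
theorem Eval.deterministic {P : Program} {env : List Val} {e : Expr} {v v' : Val} {t t' : ℕ}
    (h : Eval P env e v t) (h' : Eval P env e v' t') : v = v' ∧ t = t' := by
  induction h generalizing v' t' with
  | var h1 => cases h'; simp_all
  | const => cases h'; simp
  | cons _ _ ih1 ih2 =>
    cases h' with | cons a b => obtain ⟨rfl, rfl⟩ := ih1 a; obtain ⟨rfl, rfl⟩ := ih2 b; simp
  | head _ ih => cases h' with | head a => have := ih a; simp_all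
  | tail _ ih => cases h' with | tail a => have := ih a; simp_all
  | add _ _ ih1 ih2 => cases h' with | add a b => have := ih1 a; have := ih2 b; simp_all
  | sub _ _ ih1 ih2 => cases h' with | sub a b => have := ih1 a; have := ih2 b; simp_all
  | condTrue _ hu _ ih1 ih2 =>
    cases h' with
    | condTrue a _ b => have := ih1 a; have := ih2 b; simp_all
    | condFalse a _ => exact absurd (ih1 a).1 hu
  | condFalse _ _ ih1 ih2 =>
    cases h' with
    | condTrue a hu _ => exact absurd (ih1 a).1.symm hu
    | condFalse a b => have := ih1 a; have := ih2 b; simp_all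
  | letIn _ _ ih1 ih2 =>
    cases h' with
    | letIn a b => obtain ⟨rfl, rfl⟩ := ih1 a; obtain ⟨rfl, rfl⟩ := ih2 b; simp
  | call _ hf _ ih1 ih2 =>
    cases h' with
    | call a hg b =>
      obtain ⟨rfl, rfl⟩ := ih1 a
      obtain rfl := Option.some.inj (hf.symm.trans hg)
      obtain ⟨rfl, rfl⟩ := ih2 b
      simp

/-- On input `x`, the first function of `P` halts after `t` steps with output `y`. -/
def Program.Computes (P : Program) (x y : Val) (t : ℕ) : Prop :=
  ∃ main, P.head? = some main ∧ Eval P [x] main y t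

/-- A list of corners as an S-expression. -/
def encodeInput (C : List (List ℕ)) : Val :=
  Val.ofList (Val.ofList Val.num) C

/-- A list of sets of corners, followed by a list of lists of positions, as an S-expression. -/
def encodeOutput (S : List (List (List ℕ))) (D : List (List ℕ)) : Val :=
  .pair (Val.ofList (Val.ofList (Val.ofList Val.num)) S) (Val.ofList (Val.ofList Val.num) D)

end ConnectFour

namespace ConnectFour

/-! ### Polynomial bounds -/

/-! Counting, for each `γ`, the members that contain `γ` shows that a multiset of nonempty standard
sets decomposes `Δ` exactly when these counts are the heights of `Δ`. If `K ⊆ X \ Y` and both `X \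
K` and `Y ∪ K` are standard, then replacing `X, Y` by `X \ K, Y ∪ K` preserves all counts, so it
turns decompositions into decompositions (`IsC4Decomposition.move`). The algorithm starts from the
horizontal layers of `Δ` and explores the graph whose edges are such moves, with `K` a connected
component of the difference.

Every decomposition is reached (`mem_of_closed_under_moves`). If the members do not form a chain,
some `Y` is not contained in an at least as large `X`. Moving a minimal movable set (an atom) from
`Y` to `X` keeps the total cardinality and increases the sum of the squared cardinalities; by
induction the new decomposition is reachable, and since atoms can be moved back (`IsAtom.reverse`),
so is the old one. A chain is determined by its counts, hence is the decomposition into layers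
(`eq_layerSet_of_pairwise`).

The moves are found from corners alone. Join two outer corners of `Y` lying in `X` when their
maximum is still in `X`. The part of `X` above a connected component `Q` of this graph is movable,
and every atom has this form (`exists_movable_of_mem_moves`, `exists_mem_moves_of_isAtom`). Hence a
decomposition has few neighbors, each cheap to compute.

For the running time, `PT` collects the functions that have a program with polynomial time and
polynomially large values. It is closed under composition, branching and size-controlled folds, so
`fun_prop` derives it for one round of the search. The number of rounds and the intermediate lists
are bounded by the output instead of the input: each round but the last finds a new decomposition,
all intermediate lists are suffixes of the final one, and that list is polynomial in the size of the
output (`sz_le_sz_report`). -/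

/-- The function is given by a polynomial with natural coefficients. -/
@[fun_prop]
def IsPoly (T : ℕ → ℕ) : Prop := ∃ p : Polynomial ℕ, ∀ n, T n = p.eval n

namespace IsPoly

@[fun_prop]
theorem const (c : ℕ) : IsPoly fun _ => c := ⟨Polynomial.C c, by simp⟩

@[fun_prop]
theorem id : IsPoly fun n => n := ⟨Polynomial.X, by simp⟩

@[fun_prop]
theorem add {S T : ℕ → ℕ} (hS : IsPoly S) (hT : IsPoly T) : IsPoly fun n => S n + T n := by
  obtain ⟨p, hp⟩ := hS
  obtain ⟨q, hq⟩ := hT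
  exact ⟨p + q, by simp [hp, hq]⟩

@[fun_prop]
theorem mul {S T : ℕ → ℕ} (hS : IsPoly S) (hT : IsPoly T) : IsPoly fun n => S n * T n := by
  obtain ⟨p, hp⟩ := hS
  obtain ⟨q, hq⟩ := hT
  exact ⟨p * q, by simp [hp, hq]⟩

@[fun_prop]
theorem comp {S T : ℕ → ℕ} (hS : IsPoly S) (hT : IsPoly T) : IsPoly fun n => S (T n) := by
  obtain ⟨p, hp⟩ := hS
  obtain ⟨q, hq⟩ := hT
  exact ⟨p.comp q, by simp [hp, hq]⟩

theorem monotone {T : ℕ → ℕ} (hT : IsPoly T) : Monotone T := by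
  obtain ⟨p, hp⟩ := hT
  intro m n hmn
  simp only [hp, Polynomial.eval_eq_sum, Polynomial.sum]
  gcongr

end IsPoly

/-! ### Relocatable code -/

/-- The functions in `B` stand in the program `P` from position `o` on. -/
def HasBlock (P : Program) (o : ℕ) (B : List Expr) : Prop :=
  ∀ i e, B[i]? = some e → P[o + i]? = some e

theorem HasBlock.left {P : Program} {o : ℕ} {B B' : List Expr} (h : HasBlock P o (B ++ B')) :
    HasBlock P o B := by
  intro i e hi
  refine h i e ?_
  rw [List.getElem?_append_left (List.getElem?_eq_some_iff.1 hi).1, hi]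

theorem HasBlock.right {P : Program} {o : ℕ} {B B' : List Expr} (h : HasBlock P o (B ++ B')) :
    HasBlock P (o + B.length) B' := by
  intro i e hi
  rw [add_assoc]
  refine h _ e ?_
  rw [List.getElem?_append_right (by omega), Nat.add_sub_cancel_left, hi]

/-- An expression in one variable, together with the functions that it calls; both depend on the
position at which these functions are put into a program. -/
structure Code where
  blk : ℕ → List Expr
  len : ℕ
  length_blk : ∀ o, (blk o).length = len
  expr : ℕ → Expr

/-- Wherever the code `c` is put, it evaluates to `y` on the input `x` in `t` steps. -/
def Code.Evals (c : Code) (x y : Val) (t : ℕ) : Prop :=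
  ∀ (P : Program) (o : ℕ) (env : List Val), HasBlock P o (c.blk o) →
    Eval P (x :: env) (c.expr o) y t

namespace Code

/-- A code without functions. -/
def ofExpr (e : Expr) : Code := ⟨fun _ => [], 0, fun _ => rfl, fun _ => e⟩

/-- Composition, the code `c` first. -/
def comp (c c' : Code) : Code where
  blk o := c.blk o ++ c'.blk (o + c.len)
  len := c.len + c'.len
  length_blk o := by simp [length_blk]
  expr o := .letIn (c.expr o) (c'.expr (o + c.len))

theorem Evals.comp {c c' : Code} {x y z : Val} {s t : ℕ} (h : c.Evals x y s)
    (h' : c'.Evals y z t) : (c.comp c').Evals x z (s + t + 1) := by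
  intro P o env hP
  have hr := HasBlock.right hP
  rw [c.length_blk] at hr
  exact .letIn (h P o env (HasBlock.left hP)) (h' P _ _ hr)

/-- Pairing of the values of two codes. -/
def pair (c c' : Code) : Code where
  blk o := c.blk o ++ c'.blk (o + c.len)
  len := c.len + c'.len
  length_blk o := by simp [length_blk]
  expr o := .cons (c.expr o) (c'.expr (o + c.len))

theorem Evals.pair {c c' : Code} {x y z : Val} {s t : ℕ} (h : c.Evals x y s)
    (h' : c'.Evals x z t) : (c.pair c').Evals x (.pair y z) (s + t + 1) := by
  intro P o env hP
  have hr := HasBlock.right hP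
  rw [c.length_blk] at hr
  exact .cons (h P o env (HasBlock.left hP)) (h' P _ _ hr)

/-- Branching. -/
def ite (c a b : Code) : Code where
  blk o := c.blk o ++ (a.blk (o + c.len) ++ b.blk (o + c.len + a.len))
  len := c.len + (a.len + b.len)
  length_blk o := by simp [length_blk]
  expr o := .cond (c.expr o) (a.expr (o + c.len)) (b.expr (o + c.len + a.len))

theorem Evals.ite_true {c a : Code} (b : Code) {x u y : Val} {s t : ℕ} (h : c.Evals x u s)
    (hu : u ≠ .num 0) (h' : a.Evals x y t) : (c.ite a b).Evals x y (s + t + 1) := by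
  intro P o env hP
  have hr := HasBlock.right hP
  rw [c.length_blk] at hr
  exact .condTrue (h P o env (HasBlock.left hP)) hu (h' P _ _ hr.left)

theorem Evals.ite_false {c b : Code} (a : Code) {x y : Val} {s t : ℕ} (h : c.Evals x (.num 0) s)
    (h' : b.Evals x y t) : (c.ite a b).Evals x y (s + t + 1) := by
  intro P o env hP
  have hr := HasBlock.right hP
  rw [c.length_blk] at hr
  have hr' := hr.right
  rw [a.length_blk] at hr'
  exact .condFalse (h P o env (HasBlock.left hP)) (h' P _ _ hr')

/-- Iteration of `c'` as long as the value of `c` is not the atom `0`. -/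
def loop (c c' : Code) : Code where
  blk o := .cond (c.expr (o + 1)) (.call o (c'.expr (o + 1 + c.len))) (.var 0) ::
    (c.blk (o + 1) ++ c'.blk (o + 1 + c.len))
  len := c.len + c'.len + 1
  length_blk o := by simp [length_blk]
  expr o := .call o (.var 0)

/-- The loop is one tail-recursive function that occupies the first position of its block. Here `x
i` is the state and `u i` the value of the test after `i` rounds; the induction peels off the first
round and shifts both sequences. -/
theorem Evals.loop {c c' : Code} (x u : ℕ → Val) (s t : ℕ) (n : ℕ)
    (hu : ∀ i < n, u i ≠ .num 0) (hn : u n = .num 0)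
    (hc : ∀ i ≤ n, ∃ r ≤ s, c.Evals (x i) (u i) r)
    (hc' : ∀ i < n, ∃ r ≤ t, c'.Evals (x i) (x (i + 1)) r) :
    ∃ r ≤ (n + 1) * (s + t + 4), (c.loop c').Evals (x 0) (x n) r := by
  obtain ⟨r, hr, H⟩ : ∃ r ≤ (n + 1) * (s + t + 2), ∀ P o, HasBlock P o ((c.loop c').blk o) →
      Eval P [x 0] (.cond (c.expr (o + 1)) (.call o (c'.expr (o + 1 + c.len))) (.var 0))
        (x n) r := by
    have blocks : ∀ P o, HasBlock P o ((c.loop c').blk o) → HasBlock P (o + 1) (c.blk (o + 1)) ∧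
        HasBlock P (o + 1 + c.len) (c'.blk (o + 1 + c.len)) := by
      intro P o hP
      have h1 : HasBlock P (o + 1) (c.blk (o + 1) ++ c'.blk (o + 1 + c.len)) := by
        intro i e hi
        have := hP (i + 1) e (by simpa [Code.loop] using hi)
        rwa [show o + 1 + i = o + (i + 1) by omega]
      have hr := h1.right
      rw [c.length_blk] at hr
      exact ⟨h1.left, hr⟩
    induction n generalizing x u with
    | zero =>
      obtain ⟨r, hr, h⟩ := hc 0 le_rfl
      refine ⟨r + 1 + 1, by omega, fun P o hP => .condFalse (hn ▸ h P _ _ (blocks P o hP).1) ?_⟩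
      exact .var rfl
    | succ n ih =>
      obtain ⟨r, hr, h⟩ := hc 0 (by omega)
      obtain ⟨r', hr', h'⟩ := hc' 0 (by omega)
      obtain ⟨k, hk, H⟩ := ih (fun i => x (i + 1)) (fun i => u (i + 1))
        (fun i hi => hu _ (by omega)) hn (fun i hi => hc _ (by omega))
        (fun i hi => hc' _ (by omega))
      refine ⟨r + (r' + k + 1) + 1, ?_, fun P o hP => ?_⟩
      · have : (n + 1 + 1) * (s + t + 2) = (n + 1) * (s + t + 2) + (s + t + 2) := by ring
        omega
      · obtain ⟨h1, h2⟩ := blocks P o hP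
        refine .condTrue (h P _ _ h1) (hu 0 (by omega)) (.call (h' P _ _ h2) ?_ (H P o hP))
        exact hP 0 _ rfl
  -- The bound with `s + t + 2` concerns the body of the function; the initial call costs two more
  -- steps, absorbed by replacing `2` by `4`.
  refine ⟨1 + r + 1, by nlinarith, fun P o env hP => .call (.var rfl) (hP 0 _ rfl) (H P o hP)⟩

end Code

/-! ### Functions computable in polynomial time -/

/-- Types whose elements are represented by S-expressions. -/
class Enc (α : Type) where
  enc : α → Val

open Enc (enc)

instance : Enc ℕ := ⟨Val.num⟩

instance : Enc Bool := ⟨fun b => Val.num b.toNat⟩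

instance {α β : Type} [Enc α] [Enc β] : Enc (α × β) := ⟨fun x => .pair (enc x.1) (enc x.2)⟩

instance {α : Type} [Enc α] : Enc (List α) := ⟨Val.ofList enc⟩

/-- The size of the S-expression that represents `a`. -/
def sz {α : Type} [Enc α] (a : α) : ℕ := (enc a).size

/-! ### Sizes of encoded data -/

section sz

variable {α β : Type} [Enc α] [Enc β]

@[simp] theorem sz_nat (n : ℕ) : sz n = 1 := rfl

@[simp] theorem sz_bool (b : Bool) : sz b = 1 := rfl

@[simp] theorem sz_prod (x : α × β) : sz x = 1 + sz x.1 + sz x.2 := rfl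

@[simp] theorem sz_nil : sz ([] : List α) = 1 := rfl

@[simp] theorem sz_cons (a : α) (l : List α) : sz (a :: l) = 1 + sz a + sz l := rfl

theorem sz_list (l : List α) : sz l = 1 + (l.map fun a => 1 + sz a).sum := by
  induction l with
  | nil => rfl
  | cons a l ih => simp [ih]; omega

theorem sz_append (l l' : List α) : sz (l ++ l') + 1 = sz l + sz l' := by
  simp [sz_list]; omega

theorem sz_perm {l l' : List α} (h : l.Perm l') : sz l = sz l' := by
  rw [sz_list, sz_list, (h.map _).sum_eq]

theorem sz_reverse (l : List α) : sz l.reverse = sz l := sz_perm l.reverse_perm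

theorem sz_sublist {l l' : List α} (h : l.Sublist l') : sz l ≤ sz l' := by
  rw [sz_list, sz_list]
  exact Nat.add_le_add_left ((h.map _).sum_le_sum fun _ _ => Nat.zero_le _) 1

theorem sz_mem {a : α} {l : List α} (h : a ∈ l) : sz a ≤ sz l := by
  have := sz_sublist (List.singleton_sublist.2 h)
  simp at this
  omega

theorem length_le_sz (l : List α) : l.length ≤ sz l := by
  induction l with
  | nil => simp
  | cons a l ih => simp; omega

theorem sz_le_of_forall {l : List α} {s : ℕ} (h : ∀ a ∈ l, sz a ≤ s) :
    sz l ≤ 1 + l.length * (1 + s) := by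
  induction l with
  | nil => simp
  | cons a l ih =>
    have h1 := ih fun b hb => h b (List.mem_cons_of_mem _ hb)
    have h2 := h a List.mem_cons_self
    simp only [sz_cons, List.length_cons, Nat.succ_mul]
    omega

end sz

/-- The function `f` can be computed in polynomial time, and its values have polynomial size. -/
@[fun_prop]
def PT {α β : Type} [Enc α] [Enc β] (f : α → β) : Prop :=
  ∃ c : Code, ∃ T : ℕ → ℕ, IsPoly T ∧ ∀ a, sz (f a) ≤ T (sz a) ∧
    ∃ t ≤ T (sz a), c.Evals (enc a) (enc (f a)) t

/-- An expression whose value is a given S-expression. -/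
def quote : Val → Expr
  | .num n => .const n
  | .pair a b => .cons (quote a) (quote b)

theorem eval_quote (v : Val) : ∃ t, ∀ (P : Program) (env : List Val), Eval P env (quote v) v t := by
  induction v with
  | num n => exact ⟨1, fun _ _ => .const⟩
  | pair a b iha ihb =>
    obtain ⟨s, hs⟩ := iha
    obtain ⟨t, ht⟩ := ihb
    exact ⟨s + t + 1, fun P env => .cons (hs P env) (ht P env)⟩

namespace PT

variable {α β γ σ : Type} [Enc α] [Enc β] [Enc γ] [Enc σ]

theorem of_expr {f : α → β} (e : Expr) (k t : ℕ) (hf : ∀ a, sz (f a) ≤ k + sz a)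
    (he : ∀ P env a, Eval P (enc a :: env) e (enc (f a)) t) : PT f :=
  ⟨.ofExpr e, fun n => k + n + t, by fun_prop, fun a => ⟨(hf a).trans (Nat.le_add_right _ _),
    t, Nat.le_add_left _ _, fun P _ env _ => he P env a⟩⟩

@[fun_prop]
theorem id : PT fun a : α => a := of_expr (.var 0) 0 1 (by simp) fun _ _ _ => .var rfl

@[fun_prop]
theorem const (b : β) : PT fun _ : α => b := by
  obtain ⟨t, ht⟩ := eval_quote (enc b)
  exact of_expr (quote (enc b)) (sz b) t (by simp) fun _ _ _ => ht _ _

@[fun_prop]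
theorem comp {g : β → γ} {f : α → β} (hg : PT g) (hf : PT f) : PT fun a => g (f a) := by
  obtain ⟨c, T, hT, h⟩ := hf
  obtain ⟨c', T', hT', h'⟩ := hg
  refine ⟨c.comp c', fun n => T n + T' (T n) + 1, by fun_prop, fun a => ?_⟩
  obtain ⟨h1, t, ht, h2⟩ := h a
  obtain ⟨h3, t', ht', h4⟩ := h' (f a)
  have := hT'.monotone h1
  beta_reduce
  exact ⟨by omega, _, by omega, h2.comp h4⟩

@[fun_prop]
theorem prodMk {f : α → β} {g : α → γ} (hf : PT f) (hg : PT g) : PT fun a => (f a, g a) := by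
  obtain ⟨c, T, hT, h⟩ := hf
  obtain ⟨c', T', hT', h'⟩ := hg
  refine ⟨c.pair c', fun n => T n + T' n + 1, by fun_prop, fun a => ?_⟩
  obtain ⟨h1, t, ht, h2⟩ := h a
  obtain ⟨h3, t', ht', h4⟩ := h' a
  beta_reduce
  exact ⟨by simp; omega, _, by omega, h2.pair h4⟩

-- A nonempty list and the pair of its head and tail are encoded by the same S-expression, so
-- consing is pairing.
@[fun_prop]
theorem cons {f : α → β} {g : α → List β} (hf : PT f) (hg : PT g) : PT fun a => f a :: g a :=
  prodMk hf hg

@[fun_prop]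
theorem fst {f : α → β × γ} (hf : PT f) : PT fun a => (f a).1 :=
  comp (g := Prod.fst) (of_expr (.head (.var 0)) 0 2 (by simp; omega)
    fun _ _ _ => .head (.var rfl)) hf

@[fun_prop]
theorem snd {f : α → β × γ} (hf : PT f) : PT fun a => (f a).2 :=
  comp (g := Prod.snd) (of_expr (.tail (.var 0)) 0 2 (by simp)
    fun _ _ _ => .tail (.var rfl)) hf

@[fun_prop]
theorem add {f g : α → ℕ} (hf : PT f) (hg : PT g) : PT fun a => f a + g a :=
  comp (g := fun x : ℕ × ℕ => x.1 + x.2)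
    (of_expr (.add (.head (.var 0)) (.tail (.var 0))) 0 5 (by simp)
      fun _ _ _ => .add (.head (.var rfl)) (.tail (.var rfl))) (hf.prodMk hg)

@[fun_prop]
theorem sub {f g : α → ℕ} (hf : PT f) (hg : PT g) : PT fun a => f a - g a :=
  comp (g := fun x : ℕ × ℕ => x.1 - x.2)
    (of_expr (.sub (.head (.var 0)) (.tail (.var 0))) 0 5 (by simp)
      fun _ _ _ => .sub (.head (.var rfl)) (.tail (.var rfl))) (hf.prodMk hg)

@[fun_prop]
theorem cond {c : α → Bool} {f g : α → β} (hc : PT c) (hf : PT f) (hg : PT g) :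
    PT fun a => bif c a then f a else g a := by
  obtain ⟨k, S, hS, h⟩ := hc
  obtain ⟨c', T, hT, h'⟩ := hf
  obtain ⟨c'', T', hT', h''⟩ := hg
  refine ⟨k.ite c' c'', fun n => S n + T n + T' n + 1, by fun_prop, fun a => ?_⟩
  obtain ⟨h1, t, ht, h2⟩ := h a
  obtain ⟨h3, t', ht', h4⟩ := h' a
  obtain ⟨h5, t'', ht'', h6⟩ := h'' a
  beta_reduce
  rcases hca : c a with _ | _ <;> rw [hca] at h2
  · exact ⟨by simp only [cond_false]; omega, t + t'' + 1, by omega, h2.ite_false c' h6⟩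
  · exact ⟨by simp only [cond_true]; omega, t + t' + 1, by omega,
      h2.ite_true c'' (by simp [enc]) h4⟩

/-- The code builds the pair of `a` and `l a` and tests its second component against the atom `0`.
If `l a = b :: m`, this pair is already the encoding of the triple `(a, b, m)` on which `g` is run.
-/
theorem listCases {l : α → List β} {f : α → γ} {g : α × β × List β → γ} (hl : PT l) (hf : PT f)
    (hg : PT g) : PT fun a => match l a with
      | [] => f a
      | b :: m => g (a, b, m) := by
  obtain ⟨c, S, hS, h⟩ := PT.id.prodMk hl
  obtain ⟨c', T, hT, h'⟩ := comp hf (fst (γ := List β) PT.id)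
  obtain ⟨c'', T', hT', h''⟩ := hg
  refine ⟨c.comp (.ite (.ofExpr (.tail (.var 0))) c'' c'),
    fun n => S n + T (S n) + T' (S n) + 4, by fun_prop, fun a => ?_⟩
  obtain ⟨h1, t, ht, h2⟩ := h a
  obtain ⟨h3, t', ht', h4⟩ := h' (a, l a)
  have e1 := hT.monotone h1
  have e2 := hT'.monotone h1
  beta_reduce at *
  rcases hla : l a with _ | ⟨b, m⟩
  · rw [hla] at h1 h2 e1 e2 h3 ht' h4
    dsimp only at h3
    exact ⟨by simp only; omega, t + (2 + t' + 1) + 1, by omega, h2.comp (.ite_false _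
      (fun _ _ _ _ => .tail (.var rfl)) h4)⟩
  · rw [hla] at h1 h2 e1 e2
    obtain ⟨h5, t'', ht'', h6⟩ := h'' (a, b, m)
    change _ ≤ T' (sz (a, b :: m)) at h5
    change _ ≤ T' (sz (a, b :: m)) at ht''
    exact ⟨by simp only; omega, t + (2 + t'' + 1) + 1, by omega, h2.comp (.ite_true _
      (fun _ _ _ _ => .tail (.var rfl)) (by simp [enc, Val.ofList]) h6)⟩

/-- This is deliberately not a `PT` statement. The number of rounds `n` and the bound `s` on the
states stay free, so that they can later be bounded by the size of the output, while the code and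
`T` do not depend on them. -/
theorem loop {c : σ → Bool} {f : σ → σ} (hc : PT c) (hf : PT f) :
    ∃ k : Code, ∃ T : ℕ → ℕ, IsPoly T ∧ ∀ a n s, (∀ i < n, c (f^[i] a) = true) →
      c (f^[n] a) = false → (∀ i ≤ n, sz (f^[i] a) ≤ s) →
      ∃ t ≤ (n + 1) * T s, k.Evals (enc a) (enc (f^[n] a)) t := by
  obtain ⟨k, S, hS, h⟩ := hc
  obtain ⟨k', T, hT, h'⟩ := hf
  refine ⟨k.loop k', fun n => S n + T n + 4, by fun_prop, fun a n s hi hn hs => ?_⟩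
  refine Code.Evals.loop (fun i => enc (f^[i] a)) (fun i => enc (c (f^[i] a))) (S s) (T s) n
    (fun i hin => by simp [hi i hin, enc]) (by simp [hn, enc]) (fun i hin => ?_) fun i hin => ?_
  · obtain ⟨-, t, ht, e⟩ := h (f^[i] a)
    exact ⟨t, ht.trans (hS.monotone (hs i hin)), e⟩
  · obtain ⟨-, t, ht, e⟩ := h' (f^[i] a)
    rw [Function.iterate_succ_apply']
    exact ⟨t, ht.trans (hT.monotone (hs i hin.le)), e⟩

theorem of_eq {f g : α → β} (hf : PT f) (h : ∀ a, f a = g a) : PT g := funext h ▸ hf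

theorem exists_sz_le {f : α → β} (hf : PT f) : ∃ T, IsPoly T ∧ ∀ a, sz (f a) ≤ T (sz a) := by
  obtain ⟨_, T, hT, h⟩ := hf
  exact ⟨T, hT, fun a => (h a).1⟩

/-- Iterating a polynomial-time step can produce exponentially large values, so a polynomial bound
on the accumulator after every prefix is required. The loop state consists of the remaining list,
the accumulator and the parameter `a`. -/
theorem foldl {l : α → List β} {i : α → σ} {F : α → σ → β → σ} (hl : PT l) (hi : PT i)
    (hF : PT fun x : α × σ × β => F x.1 x.2.1 x.2.2) (Q : ℕ → ℕ) (hQ : IsPoly Q)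
    (h : ∀ a m, m <+: l a → sz (m.foldl (F a) (i a)) ≤ Q (sz a)) :
    PT fun a => (l a).foldl (F a) (i a) := by
  have hstep : PT fun x : List β × σ × α => match x.1 with
      | [] => x
      | b :: m => (m, F x.2.2 x.2.1 b, x.2.2) := by
    refine listCases (l := fun x : List β × σ × α => x.1) (f := fun x => x)
      (g := fun y => (y.2.2, F y.1.2.2 y.1.2.1 y.2.1, y.1.2.2)) (by fun_prop) (by fun_prop) ?_
    refine prodMk (by fun_prop) (prodMk ?_ (by fun_prop))
    exact comp (f := fun y : (List β × σ × α) × β × List β => (y.1.2.2, y.1.2.1, y.2.1)) hF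
      (by fun_prop)
  have htest : PT fun x : List β × σ × α => match x.1 with
      | [] => false
      | _ :: _ => true :=
    listCases (l := fun x : List β × σ × α => x.1) (f := fun _ => false) (g := fun _ => true)
      (by fun_prop) (by fun_prop) (by fun_prop)
  obtain ⟨k, T, hT, hk⟩ := loop htest hstep
  obtain ⟨c, S, hS, hc⟩ := hl.prodMk (hi.prodMk id)
  obtain ⟨c', S', hS', hc'⟩ :=
    (by fun_prop : PT fun x : List β × σ × α => x.2.1)
  refine ⟨c.comp (k.comp c'), fun n => S n + (S n + 1) * T (S n + Q n + n + 2) +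
    S' (S n + Q n + n + 2) + Q n + 2, by fun_prop, fun a => ⟨?_, ?_⟩⟩
  · have := h a _ List.prefix_rfl
    beta_reduce
    omega
  obtain ⟨h1, t, ht, h2⟩ := hc a
  have hit : ∀ j ≤ (l a).length, (fun x : List β × σ × α => match x.1 with
      | [] => x
      | b :: m => (m, F x.2.2 x.2.1 b, x.2.2))^[j] (l a, i a, a) =
        ((l a).drop j, ((l a).take j).foldl (F a) (i a), a) := by
    intro j hj
    have key : ∀ (s : σ) (l m : List β), (fun x : List β × σ × α => match x.1 with
      | [] => x
      | b :: m => (m, F x.2.2 x.2.1 b, x.2.2))^[l.length] (l ++ m, s, a) =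
        (m, l.foldl (F a) s, a) := by
      intro s l m
      induction l generalizing s with
      | nil => rfl
      | cons b l ih => simpa using ih (F a s b)
    have := key (i a) ((l a).take j) ((l a).drop j)
    rwa [List.take_append_drop, List.length_take, min_eq_left hj] at this
  simp only [sz_prod] at h1
  have hlen := length_le_sz (l a)
  have hs : ∀ j ≤ (l a).length, sz ((fun x : List β × σ × α => match x.1 with
      | [] => x
      | b :: m => (m, F x.2.2 x.2.1 b, x.2.2))^[j] (l a, i a, a)) ≤
        S (sz a) + Q (sz a) + sz a + 2 := by
    intro j hj
    rw [hit j hj]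
    simp only [sz_prod]
    have h3 := sz_sublist ((l a).drop_sublist j)
    have h4 := h a _ ((l a).take_prefix j)
    omega
  obtain ⟨r, hr, e⟩ := hk (l a, i a, a) (l a).length _ (fun j hj => by
    rw [hit j hj.le]
    rcases hd : (l a).drop j with _ | ⟨b, m⟩
    · simp at hd; omega
    · rfl) (by rw [hit _ le_rfl]; simp) hs
  have h5 := hs _ le_rfl
  rw [hit _ le_rfl] at e h5
  obtain ⟨-, t', ht', h6⟩ := hc' ((l a).drop (l a).length,
    ((l a).take (l a).length).foldl (F a) (i a), a)
  simp only [List.take_length] at h6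
  refine ⟨_, ?_, h2.comp (e.comp (by simpa using h6))⟩
  have h7 := hS'.monotone h5
  have h8 : ((l a).length + 1) * T (S (sz a) + Q (sz a) + sz a + 2) ≤
    (S (sz a) + 1) * T (S (sz a) + Q (sz a) + sz a + 2) := Nat.mul_le_mul_right _ (by omega)
  beta_reduce
  omega

@[fun_prop]
theorem reverse {l : α → List β} (hl : PT l) : PT fun a => (l a).reverse := by
  refine comp (g := List.reverse) (of_eq (f := fun l : List β => l.foldl (fun s b => b :: s) [])
    (foldl (by fun_prop) (by fun_prop) (by fun_prop) (fun n => n) (by fun_prop) ?_)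
    (by simp)) hl
  intro l m hm
  simpa [sz_reverse] using sz_sublist hm.sublist

@[fun_prop]
theorem append {l m : α → List β} (hl : PT l) (hm : PT m) : PT fun a => l a ++ m a := by
  refine comp (g := fun x : List β × List β => x.1 ++ x.2) (of_eq (f := fun x =>
    x.1.reverse.foldl (fun s b => b :: s) x.2) (foldl (by fun_prop) (by fun_prop) (by fun_prop)
      (fun n => n) (by fun_prop) ?_) (by simp)) (hl.prodMk hm)
  rintro ⟨l, m⟩ k (hk : k <+: l.reverse)
  have h1 := sz_sublist hk.sublist
  rw [sz_reverse] at h1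
  have h2 := sz_append k.reverse m
  rw [sz_reverse] at h2
  have h3 : k.foldl (fun s b => b :: s) m = k.reverse ++ m := by simp
  rw [h3]
  simp only [sz_prod]
  omega

theorem foldr {l : α → List β} {i : α → σ} {F : α → β → σ → σ} (hl : PT l) (hi : PT i)
    (hF : PT fun x : α × σ × β => F x.1 x.2.2 x.2.1) (Q : ℕ → ℕ) (hQ : IsPoly Q)
    (h : ∀ a m, m <:+ l a → sz (m.foldr (F a) (i a)) ≤ Q (sz a)) :
    PT fun a => (l a).foldr (F a) (i a) := by
  refine of_eq (f := fun a => (l a).reverse.foldl (fun s b => F a b s) (i a))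
    (foldl (by fun_prop) hi hF Q hQ fun a m hm => ?_) (by simp)
  rw [← List.foldr_reverse]
  exact h a _ (by simpa using List.reverse_suffix.2 hm)

@[fun_prop]
theorem flatMap {l : α → List β} {f : α → β → List γ} (hl : PT l)
    (hf : PT fun x : α × β => f x.1 x.2) : PT fun a => (l a).flatMap (f a) := by
  obtain ⟨S, hS, h⟩ := hl.exists_sz_le
  obtain ⟨T, hT, h'⟩ := hf.exists_sz_le
  refine of_eq (f := fun a => (l a).foldr (fun b s => f a b ++ s) []) (foldr hl (by fun_prop) ?_
    (fun n => 1 + S n * T (1 + n + S n)) (by fun_prop) ?_) (fun a => by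
      rw [List.flatMap_def]; induction l a <;> simp_all)
  · exact append (comp (f := fun x : α × List γ × β => (x.1, x.2.2)) hf (by fun_prop))
      (by fun_prop)
  intro a m hm
  have h1 : (m.length : ℕ) ≤ S (sz a) :=
    hm.length_le.trans ((length_le_sz _).trans (h a))
  refine le_trans ?_ (Nat.add_le_add_left (Nat.mul_le_mul_right _ h1) 1)
  have h2 : ∀ b ∈ m, sz (f a b) ≤ T (1 + sz a + S (sz a)) := fun b hb =>
    (h' (a, b)).trans (hT.monotone (by
      have := (sz_mem (hm.subset hb)).trans (h a)
      simp; omega))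
  clear hm h1
  induction m with
  | nil => simp
  | cons b m ih =>
    have h3 := ih fun c hc => h2 c (List.mem_cons_of_mem _ hc)
    have h4 := h2 b List.mem_cons_self
    have h5 := sz_append (f a b) (m.foldr (fun b s => f a b ++ s) [])
    simp only [List.foldr_cons, List.length_cons, Nat.succ_mul] at *
    omega

@[fun_prop]
theorem map {l : α → List β} {f : α → β → γ} (hl : PT l)
    (hf : PT fun x : α × β => f x.1 x.2) : PT fun a => (l a).map (f a) :=
  of_eq (f := fun a => (l a).flatMap fun b => [f a b]) (by fun_prop) fun a => by
    induction l a <;> simp_all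

@[fun_prop]
theorem filter {l : α → List β} {f : α → β → Bool} (hl : PT l)
    (hf : PT fun x : α × β => f x.1 x.2) : PT fun a => (l a).filter (f a) :=
  of_eq (f := fun a => (l a).flatMap fun b => bif f a b then [b] else []) (by fun_prop) fun a => by
    induction l a with
    | nil => rfl
    | cons b l ih => cases h : f a b <;> simp_all

@[fun_prop]
theorem not {f : α → Bool} (hf : PT f) : PT fun a => !f a :=
  of_eq (f := fun a => bif f a then false else true) (by fun_prop) fun a => by cases f a <;> rfl

@[fun_prop]
theorem and {f g : α → Bool} (hf : PT f) (hg : PT g) : PT fun a => f a && g a :=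
  of_eq (f := fun a => bif f a then g a else false) (by fun_prop) fun a => by cases f a <;> rfl

@[fun_prop]
theorem any {l : α → List β} {f : α → β → Bool} (hl : PT l)
    (hf : PT fun x : α × β => f x.1 x.2) : PT fun a => (l a).any (f a) := by
  refine of_eq (f := fun a => (l a).foldl (fun s b => bif s then true else f a b) false)
    (foldl hl (by fun_prop) ?_ (fun _ => 1) (by fun_prop) fun _ _ _ => le_rfl) fun a => ?_
  · exact cond (by fun_prop) (by fun_prop) (comp (f := fun x : α × Bool × β => (x.1, x.2.2)) hf
      (by fun_prop))
  · have : ∀ (l : List β) (s : Bool), l.foldl (fun s b => bif s then true else f a b) s =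
        (s || l.any (f a)) := by
      intro l
      induction l with
      | nil => simp
      | cons b l ih => intro s; rw [List.foldl_cons, ih]; cases s <;> simp
    rw [this, Bool.false_or]

@[fun_prop]
theorem all {l : α → List β} {f : α → β → Bool} (hl : PT l)
    (hf : PT fun x : α × β => f x.1 x.2) : PT fun a => (l a).all (f a) :=
  of_eq (f := fun a => !(l a).any fun b => !f a b) (by fun_prop) fun a => by
    simp [List.all_eq_not_any_not]

@[fun_prop]
theorem length {l : α → List β} (hl : PT l) : PT fun a => (l a).length :=
  of_eq (f := fun a => (l a).foldl (fun s _ => s + 1) 0)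
    (foldl hl (by fun_prop) (by fun_prop) (fun _ => 1) (by fun_prop) fun _ _ _ => le_rfl)
    (by simp)

@[fun_prop]
theorem tail {l : α → List β} (hl : PT l) : PT fun a => (l a).tail :=
  of_eq (listCases (g := fun x : α × β × List β => x.2.2) hl (const []) (by fun_prop))
    fun a => by cases l a <;> rfl

@[fun_prop]
theorem headD {l : α → List β} {f : α → β} (hl : PT l) (hf : PT f) :
    PT fun a => (l a).headD (f a) :=
  of_eq (listCases (g := fun x : α × β × List β => x.2.1) hl hf (by fun_prop))
    fun a => by cases l a <;> rfl

@[fun_prop]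
theorem decide_le {f g : α → ℕ} (hf : PT f) (hg : PT g) : PT fun a => decide (f a ≤ g a) := by
  -- Truncated subtraction provides the comparison: `1 - n` is the encoded truth value of `n = 0`,
  -- and `f a ≤ g a` means `f a - g a = 0`.
  have : PT fun n : ℕ => decide (n = 0) := by
    refine of_expr (.sub (.const 1) (.var 0)) 0 3 (fun n => by simp) fun P env n => ?_
    have : enc (decide (n = 0)) = .num (1 - n) := by
      rcases n with _ | n <;> simp [enc]
    rw [this]
    exact .sub .const (.var rfl)
  exact of_eq (this.comp (hf.sub hg)) fun a => by simp [Nat.sub_eq_zero_iff_le]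

@[fun_prop]
theorem zipWith {l : α → List β} {m : α → List γ} {f : β → γ → σ} (hl : PT l) (hm : PT m)
    (hf : PT fun x : β × γ => f x.1 x.2) : PT fun a => List.zipWith f (l a) (m a) := by
  obtain ⟨S, hS, h⟩ := hl.exists_sz_le
  obtain ⟨S', hS', h'⟩ := hm.exists_sz_le
  obtain ⟨T, hT, hfT⟩ := hf.exists_sz_le
  -- The fold runs over the first list and carries the unread part of the second together with the
  -- results in reverse order.
  have key : ∀ (l : List β) (m : List γ) (s : List σ),
      l.foldl (fun (s : List γ × List σ) b => match s.1 with
        | [] => s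
        | c :: m => (m, f b c :: s.2)) (m, s) =
      (m.drop l.length, (List.zipWith f l m).reverse ++ s) := by
    intro l
    induction l with
    | nil => simp
    | cons b l ih =>
      intro m s
      rcases m with _ | ⟨c, m⟩
      · simpa using ih [] s
      · simpa using ih m _
  refine of_eq (f := fun a => ((l a).foldl (fun (s : List γ × List σ) b => match s.1 with
        | [] => s
        | c :: m => (m, f b c :: s.2)) (m a, [])).2.reverse) (reverse (snd (foldl hl (by fun_prop) ?_
    (fun n => 1 + S' n + (1 + S n * (1 + T (1 + S n + S' n)))) (by fun_prop) ?_))) fun a => by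
      simp [key]
  · refine listCases (g := fun x : (α × (List γ × List σ) × β) × γ × List γ =>
      (x.2.2, f x.1.2.2 x.2.1 :: x.1.2.1.2)) (by fun_prop) (by fun_prop) (prodMk (by fun_prop) (cons
        (comp (f := fun x : (α × (List γ × List σ) × β) × γ × List γ => (x.1.2.2, x.2.1)) hf
          (by fun_prop)) (by fun_prop)))
  · intro a k hk
    rw [key]
    simp only [List.append_nil, sz_prod, sz_reverse]
    have h1 := (sz_sublist ((m a).drop_sublist k.length)).trans (h' a)
    have h2 : sz (List.zipWith f k (m a)) ≤ 1 + (List.zipWith f k (m a)).length *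
        (1 + T (1 + S (sz a) + S' (sz a))) := by
      refine sz_le_of_forall fun x hx => ?_
      rw [← List.map_uncurry_zip_eq_zipWith] at hx
      obtain ⟨⟨b, c⟩, hbc, rfl⟩ := List.mem_map.1 hx
      have h3 := (sz_mem (hk.subset (List.of_mem_zip hbc).1)).trans (h a)
      have h4 := (sz_mem (List.of_mem_zip hbc).2).trans (h' a)
      exact (hfT (b, c)).trans (hT.monotone (by simp; omega))
    have h3 : (List.zipWith f k (m a)).length ≤ S (sz a) := by
      have := hk.length_le
      have := length_le_sz (l a)
      have := h a
      simp; omega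
    have h4 := Nat.mul_le_mul_right (1 + T (1 + S (sz a) + S' (sz a))) h3
    omega

end PT

/-! ### The algorithm

A standard set is given by the list of its outer corners, a decomposition by the list of its
members. -/

/-- Componentwise comparison. -/
def vle (u v : List ℕ) : Bool := (List.zipWith (fun a b => decide (a ≤ b)) u v).all fun b => b

/-- Componentwise maximum. -/
def vsup (u v : List ℕ) : List ℕ := List.zipWith (fun a b => a + (b - a)) u v

/-- Equality of vectors of the same length. -/
def veq (u v : List ℕ) : Bool := vle u v && vle v u

/-- Whether `x` lies above some element of `G`. -/
def above (G : List (List ℕ)) (x : List ℕ) : Bool := G.any fun g => vle g x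

/-- Add to `S` those members of `l` that are not yet in it, up to the relation `r`. -/
def insertAll {α : Type} (r : α → α → Bool) (l S : List α) : List α :=
  l.foldr (fun x S => bif S.any (r x) then S else x :: S) S

/-- The minimal elements of `G`. -/
def minimals (G : List (List ℕ)) : List (List ℕ) :=
  (insertAll veq G []).filter fun g => G.all fun x => bif vle x g then vle g x else true

/-- One step of the computation of a connected component. -/
def spread (X Q₀ Q : List (List ℕ)) : List (List ℕ) :=
  Q₀.filter fun p => Q.any fun r => !above X (vsup p r)

/-- The connected component of `q` in the graph on `Q₀` in which `p` and `r` are adjacent if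
their maximum does not lie above any element of `X`. -/
def component (X Q₀ : List (List ℕ)) (q : List ℕ) : List (List ℕ) :=
  Q₀.foldl (fun Q _ => spread X Q₀ Q) [q]

/-- The corners of `X` without the component `K` that is generated by `Q`, and of the union of `Y`
and `K`. -/
def exchange (X Y Q : List (List ℕ)) : List (List ℕ) × List (List ℕ) :=
  (minimals (X ++ Q), minimals ((Y.filter fun r => !Q.any fun q => veq r q) ++
    Q.flatMap fun p => X.map fun c => vsup p c))

/-- All pairs that arise from `X` and `Y` when a component of the difference is moved. -/
def moves (X Y : List (List ℕ)) : List (List (List ℕ) × List (List ℕ)) :=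
  (Y.filter fun q => !above X q).map fun q =>
    exchange X Y (component X (Y.filter fun q => !above X q) q)

/-- A list without its `i`-th member, and this member, for all `i`. -/
def picks {α : Type} (l : List α) : List (α × List α) :=
  (l.foldr (fun x s => (x :: s.1, (x, s.1) :: s.2.map fun y => (y.1, x :: y.2)))
    (([] : List α), ([] : List (α × List α)))).2

/-- All decompositions that arise from `L` by one move. -/
def neighbors (L : List (List (List ℕ))) : List (List (List (List ℕ))) :=
  (picks L).flatMap fun x => (picks x.2).flatMap fun y =>
    (moves x.1 y.1).map fun z => z.1 :: z.2 :: y.2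

/-- Equality of standard sets. -/
def seteq (G G' : List (List ℕ)) : Bool := (G.all fun g => above G' g) && G'.all fun g => above G g

/-- The multiplicity of `G` in `L`. -/
def mult (G : List (List ℕ)) (L : List (List (List ℕ))) : ℕ :=
  (L.filter fun G' => seteq G G').length

/-- Equality of decompositions. -/
def deceq (L L' : List (List (List ℕ))) : Bool :=
  (L ++ L').all fun G => decide (mult G L ≤ mult G L') && decide (mult G L' ≤ mult G L)

/-- Add all new neighbors. -/
def grow (S : List (List (List (List ℕ)))) : List (List (List (List ℕ))) :=
  insertAll deceq (S.flatMap neighbors) S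

/-- Whether there are new neighbors. -/
def growing (S : List (List (List (List ℕ)))) : Bool := !decide ((grow S).length ≤ S.length)

/-- The last coordinate. -/
def last (c : List ℕ) : ℕ := c.reverse.headD 0

/-- All coordinates but the last. -/
def init (c : List ℕ) : List ℕ := c.reverse.tail.reverse

/-- The layer at height `k` of the standard set with corners `C`. -/
def layer (C : List (List ℕ)) (k : ℕ) : List (List ℕ) :=
  minimals ((C.filter fun c => decide (last c ≤ k)).map fun c => init c)

/-- The number of layers of the standard set with corners `C`. -/
def numLayers (C : List (List ℕ)) : ℕ :=
  ((C.filter fun c => (init c).all fun a => decide (a ≤ 0)).map fun c => last c).headD 0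

/-- One step of the computation of the list of all layers. -/
def layerStep (s : List (List ℕ) × ℕ × List (List (List ℕ))) :
    List (List ℕ) × ℕ × List (List (List ℕ)) :=
  (s.1, s.2.1 - 1, layer s.1 (s.2.1 - 1) :: s.2.2)

/-- The position of `G` in `U`. -/
def position (G : List (List ℕ)) (U : List (List (List ℕ))) : ℕ :=
  U.foldr (fun G' n => bif seteq G G' then 0 else n + 1) 0

/-- The standard sets that occur in the decompositions in `S`. -/
def occurring (S : List (List (List (List ℕ)))) : List (List (List ℕ)) :=
  insertAll seteq (S.flatMap fun L => L) []

/-- The output, from the list of all decompositions. -/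
def report (S : List (List (List (List ℕ)))) : List (List (List ℕ)) × List (List ℕ) :=
  (occurring S, S.map fun L => L.map fun G => position G (occurring S))

/-! ### Polynomial running time of the single steps of the algorithm -/

namespace PT

variable {α β : Type} [Enc α] [Enc β]

@[fun_prop]
theorem vle {f g : α → List ℕ} (hf : PT f) (hg : PT g) : PT fun a => vle (f a) (g a) := by
  unfold ConnectFour.vle; fun_prop

@[fun_prop]
theorem vsup {f g : α → List ℕ} (hf : PT f) (hg : PT g) : PT fun a => vsup (f a) (g a) := by
  unfold ConnectFour.vsup; fun_prop

@[fun_prop]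
theorem veq {f g : α → List ℕ} (hf : PT f) (hg : PT g) : PT fun a => veq (f a) (g a) := by
  unfold ConnectFour.veq; fun_prop

@[fun_prop]
theorem above {f : α → List (List ℕ)} {g : α → List ℕ} (hf : PT f) (hg : PT g) :
    PT fun a => above (f a) (g a) := by
  unfold ConnectFour.above; fun_prop

theorem sz_insertAll (r : α → α → Bool) (l S : List α) : sz (insertAll r l S) ≤ sz l + sz S := by
  induction l with
  | nil => simp [insertAll]
  | cons x l ih =>
    simp only [insertAll, List.foldr_cons] at ih ⊢
    cases (List.any _ (r x)) <;> simp <;> omega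

@[fun_prop]
theorem insertAll {r : β → β → Bool} {l S : α → List β} (hr : PT fun x : β × β => r x.1 x.2)
    (hl : PT l) (hS : PT S) : PT fun a => insertAll r (l a) (S a) := by
  obtain ⟨T, hT, h⟩ := hl.exists_sz_le
  obtain ⟨T', hT', h'⟩ := hS.exists_sz_le
  refine foldr hl hS ?_ (fun n => T n + T' n) (by fun_prop) fun a m hm => ?_
  · have := comp (f := fun y : (α × List β × β) × β => (y.1.2.2, y.2)) hr (by fun_prop)
    fun_prop
  · have h1 := sz_insertAll r m (S a)
    have h2 := sz_sublist hm.sublist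
    have h3 := h a
    have h4 := h' a
    unfold ConnectFour.insertAll at h1
    omega

@[fun_prop]
theorem minimals {f : α → List (List ℕ)} (hf : PT f) : PT fun a => minimals (f a) := by
  unfold ConnectFour.minimals; fun_prop

@[fun_prop]
theorem spread {f g h : α → List (List ℕ)} (hf : PT f) (hg : PT g) (hh : PT h) :
    PT fun a => spread (f a) (g a) (h a) := by
  unfold ConnectFour.spread; fun_prop

-- After at least one round the accumulator is a sublist of the vertex list, so its size does not
-- grow with the number of rounds.
@[fun_prop]
theorem component {f g : α → List (List ℕ)} {h : α → List ℕ} (hf : PT f) (hg : PT g) (hh : PT h) :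
    PT fun a => component (f a) (g a) (h a) := by
  unfold ConnectFour.component
  obtain ⟨T, hT, hT'⟩ := hg.exists_sz_le
  obtain ⟨S, hS, hS'⟩ := hh.exists_sz_le
  refine foldl hg (by fun_prop) (by fun_prop) (fun n => T n + S n + 2) (by fun_prop) ?_
  intro a m _
  have h1 := hT' a
  have h2 := hS' a
  rcases List.eq_nil_or_concat m with rfl | ⟨m, b, rfl⟩
  · simp; omega
  · have := sz_sublist (List.filter_sublist (l := g a) (p := fun p => (m.foldl (fun Q _ =>
      ConnectFour.spread (f a) (g a) Q) [h a]).any fun r =>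
        !ConnectFour.above (f a) (ConnectFour.vsup p r)))
    simp only [List.concat_eq_append, List.foldl_append, List.foldl_cons, List.foldl_nil]
    rw [ConnectFour.spread]
    omega

@[fun_prop]
theorem exchange {f g h : α → List (List ℕ)} (hf : PT f) (hg : PT g) (hh : PT h) :
    PT fun a => exchange (f a) (g a) (h a) := by
  unfold ConnectFour.exchange; fun_prop

@[fun_prop]
theorem moves {f g : α → List (List ℕ)} (hf : PT f) (hg : PT g) :
    PT fun a => moves (f a) (g a) := by
  unfold ConnectFour.moves; fun_prop

/-- The fold rebuilds the list in its first component, because each step needs the tail that follows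
the current member. -/
theorem foldr_picks {α : Type} (l : List α) :
    l.foldr (fun x s => (x :: s.1, (x, s.1) :: s.2.map fun y => (y.1, x :: y.2)))
      (([] : List α), ([] : List (α × List α))) = (l, ConnectFour.picks l) := by
  induction l with
  | nil => rfl
  | cons x l ih => rw [ConnectFour.picks, List.foldr_cons, ih]

theorem picks_cons {α : Type} (x : α) (l : List α) : ConnectFour.picks (x :: l) =
    (x, l) :: (ConnectFour.picks l).map fun y => (y.1, x :: y.2) := by
  rw [ConnectFour.picks, List.foldr_cons, foldr_picks]

theorem perm_of_mem_picks {α : Type} {l : List α} {y : α × List α}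
    (h : y ∈ ConnectFour.picks l) : l.Perm (y.1 :: y.2) := by
  induction l generalizing y with
  | nil => simp [ConnectFour.picks] at h
  | cons x l ih =>
    rw [picks_cons, List.mem_cons, List.mem_map] at h
    rcases h with rfl | ⟨z, hz, rfl⟩
    · exact .refl _
    · exact ((ih hz).cons x).trans (.swap _ _ _)

theorem length_picks {α : Type} (l : List α) : (ConnectFour.picks l).length = l.length := by
  induction l with
  | nil => rfl
  | cons x l ih => simp [picks_cons, ih]

@[fun_prop]
theorem picks {f : α → List β} (hf : PT f) : PT fun a => picks (f a) := by
  refine comp (g := ConnectFour.picks) ?_ hf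
  refine snd (foldr (by fun_prop) (by fun_prop) (by fun_prop) (fun n => 1 + n + (1 + n * (1 + n)))
    (by fun_prop) fun l m hm => ?_)
  rw [foldr_picks]
  have h1 := sz_sublist hm.sublist
  have h2 : sz (ConnectFour.picks m) ≤ 1 + (ConnectFour.picks m).length * (1 + sz l) := by
    refine sz_le_of_forall fun y hy => ?_
    have := sz_perm (perm_of_mem_picks hy)
    simp at this ⊢
    omega
  rw [length_picks] at h2
  have h3 := Nat.mul_le_mul_right (1 + sz l) (((length_le_sz m).trans h1))
  simp only [sz_prod]
  omega

@[fun_prop]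
theorem neighbors {f : α → List (List (List ℕ))} (hf : PT f) : PT fun a => neighbors (f a) := by
  unfold ConnectFour.neighbors; fun_prop

@[fun_prop]
theorem seteq {f g : α → List (List ℕ)} (hf : PT f) (hg : PT g) :
    PT fun a => seteq (f a) (g a) := by
  unfold ConnectFour.seteq; fun_prop

@[fun_prop]
theorem mult {f : α → List (List ℕ)} {g : α → List (List (List ℕ))} (hf : PT f) (hg : PT g) :
    PT fun a => mult (f a) (g a) := by
  unfold ConnectFour.mult; fun_prop

@[fun_prop]
theorem deceq {f g : α → List (List (List ℕ))} (hf : PT f) (hg : PT g) :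
    PT fun a => deceq (f a) (g a) := by
  unfold ConnectFour.deceq; fun_prop

@[fun_prop]
theorem grow : PT grow := by
  unfold ConnectFour.grow; fun_prop

@[fun_prop]
theorem growing : PT growing := by
  unfold ConnectFour.growing; fun_prop

@[fun_prop]
theorem last {f : α → List ℕ} (hf : PT f) : PT fun a => last (f a) := by
  unfold ConnectFour.last; fun_prop

@[fun_prop]
theorem init {f : α → List ℕ} (hf : PT f) : PT fun a => init (f a) := by
  unfold ConnectFour.init; fun_prop

@[fun_prop]
theorem layer {f : α → List (List ℕ)} {g : α → ℕ} (hf : PT f) (hg : PT g) :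
    PT fun a => layer (f a) (g a) := by
  unfold ConnectFour.layer; fun_prop

@[fun_prop]
theorem numLayers : PT numLayers := by
  unfold ConnectFour.numLayers; fun_prop

theorem layerStep : PT layerStep := by
  unfold ConnectFour.layerStep; fun_prop

@[fun_prop]
theorem position {f : α → List (List ℕ)} {g : α → List (List (List ℕ))} (hf : PT f) (hg : PT g) :
    PT fun a => position (f a) (g a) := by
  unfold ConnectFour.position
  exact foldr hg (by fun_prop) (by fun_prop) (fun _ => 1) (by fun_prop) fun _ _ _ => le_rfl

@[fun_prop]
theorem occurring {f : α → List (List (List (List ℕ)))} (hf : PT f) :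
    PT fun a => occurring (f a) := by
  unfold ConnectFour.occurring; fun_prop

theorem report : PT report := by
  unfold ConnectFour.report; fun_prop

end PT

/-! ### Vectors -/

section vectors

variable {d : ℕ}

theorem vle_ofFn (x y : Fin d → ℕ) : vle (List.ofFn x) (List.ofFn y) = true ↔ x ≤ y := by
  induction d with
  | zero => simp [vle]
  | succ d ih =>
    have := ih (fun i => x i.succ) (fun i => y i.succ)
    simp only [vle, Pi.le_def] at this
    simp only [vle, List.ofFn_succ, List.zipWith_cons_cons, List.all_cons, Bool.and_eq_true, this,
      Pi.le_def, Fin.forall_fin_succ, decide_eq_true_eq]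

theorem vsup_ofFn (x y : Fin d → ℕ) : vsup (List.ofFn x) (List.ofFn y) = List.ofFn (x ⊔ y) := by
  induction d with
  | zero => simp [vsup]
  | succ d ih =>
    have := ih (fun i => x i.succ) (fun i => y i.succ)
    simp only [vsup] at this
    simp only [vsup, List.ofFn_succ, List.zipWith_cons_cons, this, List.cons.injEq]
    refine ⟨?_, rfl⟩
    rw [Pi.sup_apply]
    omega

theorem veq_ofFn (x y : Fin d → ℕ) : veq (List.ofFn x) (List.ofFn y) = true ↔ x = y := by
  rw [veq, Bool.and_eq_true, vle_ofFn, vle_ofFn, le_antisymm_iff]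

theorem above_map (A : List (Fin d → ℕ)) (x : Fin d → ℕ) :
    above (A.map List.ofFn) (List.ofFn x) = true ↔ ∃ a ∈ A, a ≤ x := by
  simp [above, vle_ofFn]

theorem mem_map_ofFn {A : List (Fin d → ℕ)} {x : Fin d → ℕ} :
    List.ofFn x ∈ A.map List.ofFn ↔ x ∈ A :=
  List.mem_map_of_injective List.ofFn_injective

theorem exists_map_ofFn {A : List (Fin d → ℕ)} {l : List (List ℕ)}
    (h : ∀ x ∈ l, x ∈ A.map List.ofFn) : ∃ B : List (Fin d → ℕ), l = B.map List.ofFn := by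
  have : l ∈ Set.range (List.map (List.ofFn (n := d) (α := ℕ))) := by
    rw [Set.range_list_map]
    intro x hx
    obtain ⟨a, -, ha⟩ := List.mem_map.1 (h x hx)
    exact ⟨a, ha⟩
  obtain ⟨B, hB⟩ := this
  exact ⟨B, hB.symm⟩

end vectors

/-! ### Lists without repetition -/

section insertAll

variable {α : Type} {r : α → α → Bool} {l S : List α}

theorem insertAll_cons (x : α) : insertAll r (x :: l) S =
    bif (insertAll r l S).any (r x) then insertAll r l S else x :: insertAll r l S := rfl

theorem suffix_insertAll (r : α → α → Bool) (l S : List α) : S <:+ insertAll r l S := by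
  induction l with
  | nil => exact List.suffix_rfl
  | cons x l ih =>
    rw [insertAll_cons]
    cases (insertAll r l S).any (r x)
    · exact ih.trans (List.suffix_cons _ _)
    · exact ih

theorem mem_or_mem_of_mem_insertAll {x : α} (h : x ∈ insertAll r l S) : x ∈ l ∨ x ∈ S := by
  induction l with
  | nil => exact .inr h
  | cons y l ih =>
    rw [insertAll_cons] at h
    cases hy : (insertAll r l S).any (r y) <;> simp only [hy, cond_true, cond_false] at h
    · rcases List.mem_cons.1 h with rfl | h
      · simp
      · exact (ih h).imp_left (List.mem_cons_of_mem _)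
    · exact (ih h).imp_left (List.mem_cons_of_mem _)

theorem exists_mem_insertAll (hr : ∀ x ∈ l, r x x = true) {x : α} (h : x ∈ l) :
    ∃ y ∈ insertAll r l S, r x y = true := by
  induction l with
  | nil => simp at h
  | cons z l ih =>
    rw [insertAll_cons]
    have ih := ih fun x hx => hr x (List.mem_cons_of_mem _ hx)
    cases hz : (insertAll r l S).any (r z) <;> simp only [cond_true, cond_false]
    · rcases List.mem_cons.1 h with rfl | h
      · exact ⟨x, by simp, hr x (by simp)⟩
      · obtain ⟨y, hy, hxy⟩ := ih h
        exact ⟨y, List.mem_cons_of_mem _ hy, hxy⟩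
    · rcases List.mem_cons.1 h with rfl | h
      · simpa using hz
      · exact ih h

theorem pairwise_insertAll (hS : S.Pairwise fun x y => r x y = false) :
    (insertAll r l S).Pairwise fun x y => r x y = false := by
  induction l with
  | nil => exact hS
  | cons x l ih =>
    rw [insertAll_cons]
    cases hx : (insertAll r l S).any (r x) <;> simp only [cond_true, cond_false]
    · exact List.pairwise_cons.2 ⟨by simpa using hx, ih⟩
    · exact ih

end insertAll

/-! ### Standard sets and their generators -/

section generators

variable {d : ℕ} {Γ X Y K : Finset (Fin d → ℕ)}

/-- The complement of `Γ` is the upper set generated by `A`. -/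
def Generates (A : List (Fin d → ℕ)) (Γ : Finset (Fin d → ℕ)) : Prop :=
  ∀ x, x ∉ Γ ↔ ∃ a ∈ A, a ≤ x

theorem IsStandard.mem_of_le (h : IsStandard Γ) {x y : Fin d → ℕ} (hxy : x ≤ y) (hy : y ∈ Γ) :
    x ∈ Γ :=
  (isStandard_iff_isLowerSet Γ).1 h hxy hy

theorem isStandard_of_forall (h : ∀ x y, x ≤ y → y ∈ Γ → x ∈ Γ) : IsStandard Γ :=
  (isStandard_iff_isLowerSet Γ).2 fun _ _ hxy hy => h _ _ hxy hy

theorem IsStandard.zero_mem (h : IsStandard Γ) (hΓ : Γ.Nonempty) : 0 ∈ Γ := by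
  obtain ⟨x, hx⟩ := hΓ
  exact h.mem_of_le (Pi.le_def.2 fun _ => Nat.zero_le _) hx

theorem Generates.isStandard {A : List (Fin d → ℕ)} (h : Generates A Γ) : IsStandard Γ := by
  refine isStandard_of_forall fun x y hxy hy => ?_
  by_contra hx
  obtain ⟨a, ha, hax⟩ := (h x).1 hx
  exact (h y).2 ⟨a, ha, hax.trans hxy⟩ hy

theorem generates_of_corners (hΓ : IsStandard Γ) {A : List (Fin d → ℕ)}
    (hA : ∀ a, a ∈ A ↔ IsOuterCorner Γ a) : Generates A Γ := by
  intro x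
  constructor
  · intro hx
    obtain ⟨a, hax, ha⟩ := exists_minimal_le_of_wellFoundedLT (fun β => β ∉ Γ) x hx
    exact ⟨a, (hA a).2 ha, hax⟩
  · rintro ⟨a, ha, hax⟩ hx
    exact ((hA a).1 ha).1 (hΓ.mem_of_le hax hx)

/-- Every minimal element of the complement lies above a generator and hence is one. Thus it
suffices to remove repetitions and the generators that lie strictly above another one. -/
theorem isCornerList_minimals {A : List (Fin d → ℕ)} (h : Generates A Γ) :
    IsCornerList Γ (minimals (A.map List.ofFn)) := by
  have h1 : ∀ x ∈ insertAll veq (A.map List.ofFn) [], x ∈ A.map List.ofFn := fun x hx => by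
    simpa using mem_or_mem_of_mem_insertAll hx
  have h2 : ∀ a ∈ A, List.ofFn a ∈ insertAll veq (A.map List.ofFn) [] := by
    intro a ha
    obtain ⟨y, hy, hay⟩ := exists_mem_insertAll (r := veq) (l := A.map List.ofFn) (S := [])
      (by simp [veq_ofFn]) (mem_map_ofFn.2 ha)
    obtain ⟨b, -, rfl⟩ := List.mem_map.1 (h1 y hy)
    obtain rfl := (veq_ofFn _ _).1 hay
    exact hy
  obtain ⟨B, hB⟩ := exists_map_ofFn (l := minimals (A.map List.ofFn)) fun x hx =>
    h1 x (List.mem_of_mem_filter hx)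
  refine ⟨B, ?_, fun a => ?_, hB⟩
  · have h3 : (minimals (A.map List.ofFn)).Pairwise fun x y => veq x y = false :=
      (pairwise_insertAll .nil).filter _
    rw [hB, List.pairwise_map] at h3
    refine h3.imp fun {a b} hab hab' => ?_
    rw [(veq_ofFn a b).2 hab'] at hab
    exact absurd hab (by simp)
  · rw [← mem_map_ofFn (x := a), ← hB, minimals, List.mem_filter]
    have h4 : (List.ofFn a ∈ insertAll veq (A.map List.ofFn) []) ↔ a ∈ A :=
      ⟨fun h => mem_map_ofFn.1 (h1 _ h), h2 a⟩
    have h5 : ((A.map List.ofFn).all fun x => bif vle x (List.ofFn a) then vle (List.ofFn a) x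
        else true) = true ↔ ∀ b ∈ A, b ≤ a → a ≤ b := by
      simp only [List.all_map, List.all_eq_true, Function.comp]
      refine forall₂_congr fun b _ => ?_
      have h6 := vle_ofFn b a
      have h7 := vle_ofFn a b
      cases h8 : vle (List.ofFn b) (List.ofFn a) <;> simp_all
    rw [h4, h5]
    constructor
    · rintro ⟨ha, hmin⟩
      refine ⟨(h a).2 ⟨a, ha, le_rfl⟩, fun y hy hya => ?_⟩
      obtain ⟨b, hb, hby⟩ := (h y).1 hy
      exact (hmin b hb (hby.trans hya)).trans hby
    · rintro ⟨ha, hmin⟩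
      obtain ⟨b, hb, hba⟩ := (h a).1 ha
      have hmem : ∀ c ∈ A, c ∉ Γ := fun c hc => (h c).2 ⟨c, hc, le_rfl⟩
      obtain rfl := le_antisymm hba (hmin (hmem b hb) hba)
      exact ⟨hb, fun c hc hcb => hmin (hmem c hc) hcb⟩

theorem IsCornerList.exists_generates (hΓ : IsStandard Γ) {G : List (List ℕ)}
    (h : IsCornerList Γ G) : ∃ A : List (Fin d → ℕ), G = A.map List.ofFn ∧ Generates A Γ ∧
      ∀ a, a ∈ A ↔ IsOuterCorner Γ a := by
  obtain ⟨A, -, hA, rfl⟩ := h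
  exact ⟨A, rfl, generates_of_corners hΓ hA, hA⟩

/-- An inclusion between complements can be tested on generators, so equality of standard sets does
not depend on the order of their corners. -/
theorem seteq_iff {G G' : List (List ℕ)} (hX : IsStandard X) (hG : IsCornerList X G)
    (hY : IsStandard Y) (hG' : IsCornerList Y G') : seteq G G' = true ↔ X = Y := by
  obtain ⟨A, rfl, hA, -⟩ := hG.exists_generates hX
  obtain ⟨B, rfl, hB, -⟩ := hG'.exists_generates hY
  have key : ∀ {A B : List (Fin d → ℕ)} {X Y : Finset (Fin d → ℕ)}, Generates A X →
      Generates B Y → (((A.map List.ofFn).all fun g => above (B.map List.ofFn) g) = true ↔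
        Y ⊆ X) := by
    intro A B X Y hA hB
    simp only [List.all_map, List.all_eq_true, Function.comp, above_map, ← hB _]
    constructor
    · intro h y hy
      by_contra hyX
      obtain ⟨a, ha, hay⟩ := (hA y).1 hyX
      exact h a ha (hB.isStandard.mem_of_le hay hy)
    · intro h a ha haY
      exact (hA a).2 ⟨a, ha, le_rfl⟩ (h haY)
  rw [seteq, Bool.and_eq_true, key hA hB, key hB hA, Finset.Subset.antisymm_iff, and_comm]

/-- Any two encodings of the same set therefore have equal size, which allows sets stored during the
search to be compared with those in the output. -/
theorem IsCornerList.perm {G G' : List (List ℕ)} (h : IsCornerList X G)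
    (h' : IsCornerList X G') : G.Perm G' := by
  obtain ⟨A, hA, hA', rfl⟩ := h
  obtain ⟨B, hB, hB', rfl⟩ := h'
  exact ((List.perm_ext_iff_of_nodup hA hB).2 fun a => (hA' a).trans (hB' a).symm).map _

/-! ### Moving components -/

open Classical in
/-- The part of `X` above the elements of `Q`. -/
noncomputable def upperPart (X : Finset (Fin d → ℕ)) (Q : List (Fin d → ℕ)) : Finset (Fin d → ℕ) :=
  X.filter fun x => ∃ q ∈ Q, q ≤ x

theorem mem_upperPart {Q : List (Fin d → ℕ)} {x : Fin d → ℕ} :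
    x ∈ upperPart X Q ↔ x ∈ X ∧ ∃ q ∈ Q, q ≤ x := by
  simp [upperPart]

/-- The set `K` consists of elements of `X` that are not in `Y`, and moving it from `X` to `Y`
yields standard sets. -/
structure Movable (X Y K : Finset (Fin d → ℕ)) : Prop where
  nonempty : K.Nonempty
  subset : K ⊆ X \ Y
  sdiff : IsStandard (X \ K)
  union : IsStandard (Y ∪ K)

/-- A minimal movable set. -/
def IsAtom (X Y K : Finset (Fin d → ℕ)) : Prop :=
  Movable X Y K ∧ ∀ K' ⊆ K, Movable X Y K' → K' = K

/-! ### Generators after an exchange, and the search for components -/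

variable {A B Q : List (Fin d → ℕ)}

theorem generates_sdiff (hA : Generates A X) :
    Generates (A ++ Q) (X \ upperPart X Q) := by
  intro x
  have := hA x
  simp only [Finset.mem_sdiff, mem_upperPart, List.mem_append, or_and_right, exists_or, ← this]
  by_cases hx : x ∈ X <;> simp [hx]

/-- A point outside `Y` that has left the part of `X` above `Q` lies either above a generator of `Y`
not in `Q`, or above both some `p ∈ Q` and a generator of the complement of `X`. The closedness `hQ`
of `Q` is needed for the converse: no point of `X` lies above both an element of `Q` and a generator
of `Y` outside `Q`. -/
theorem generates_union (hA : Generates A X) (hB : Generates B Y) (hQB : ∀ q ∈ Q, q ∈ B)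
    (hQ : ∀ q ∈ Q, ∀ p ∈ B, q ⊔ p ∈ X → p ∈ Q) :
    Generates ((B.filter fun r => !decide (r ∈ Q)) ++ Q.flatMap fun p => A.map fun c => p ⊔ c)
      (Y ∪ upperPart X Q) := by
  intro x
  simp only [Finset.mem_union, mem_upperPart, not_or, List.mem_append, List.mem_filter,
    List.mem_flatMap, List.mem_map]
  constructor
  · rintro ⟨h1, h2⟩
    obtain ⟨b, hb, hbx⟩ := (hB x).1 h1
    by_cases hbQ : b ∈ Q
    · have hx : x ∉ X := fun hx => h2 ⟨hx, b, hbQ, hbx⟩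
      obtain ⟨a, ha, hax⟩ := (hA x).1 hx
      exact ⟨b ⊔ a, .inr ⟨b, hbQ, a, ha, rfl⟩, sup_le hbx hax⟩
    · exact ⟨b, .inl ⟨hb, by simpa using hbQ⟩, hbx⟩
  · rintro ⟨b, ⟨hb, hbQ⟩ | ⟨q, hq, a, ha, rfl⟩, hbx⟩
    · refine ⟨(hB x).2 ⟨b, hb, hbx⟩, ?_⟩
      rintro ⟨hx, q, hq, hqx⟩
      have := hQ q hq b hb (hA.isStandard.mem_of_le (sup_le hqx hbx) hx)
      simp [this] at hbQ
    · refine ⟨(hB x).2 ⟨q, hQB q hq, le_sup_left.trans hbx⟩, fun h => ?_⟩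
      exact (hA x).2 ⟨a, ha, le_sup_right.trans hbx⟩ h.1

/-- The step of the computation of a component, for vectors. -/
def spreadSet (X : Finset (Fin d → ℕ)) (P Q : List (Fin d → ℕ)) : List (Fin d → ℕ) :=
  P.filter fun p => Q.any fun r => decide (p ⊔ r ∈ X)

theorem mem_spreadSet {P : List (Fin d → ℕ)} {p : Fin d → ℕ} :
    p ∈ spreadSet X P Q ↔ p ∈ P ∧ ∃ r ∈ Q, p ⊔ r ∈ X := by
  simp [spreadSet]

theorem spread_map (hA : Generates A X) (P Q : List (Fin d → ℕ)) :
    spread (A.map List.ofFn) (P.map List.ofFn) (Q.map List.ofFn) =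
      (spreadSet X P Q).map List.ofFn := by
  rw [spread, List.filter_map, spreadSet]
  congr 1
  refine List.filter_congr fun p _ => ?_
  rw [Function.comp, List.any_map]
  refine List.any_congr rfl fun q => ?_
  rw [Function.comp, vsup_ofFn, Bool.eq_iff_iff, Bool.not_eq_true', ← Bool.not_eq_true, above_map,
    ← hA, not_not, decide_eq_true_iff]

theorem component_map (hA : Generates A X) (P : List (Fin d → ℕ)) (q : Fin d → ℕ) :
    component (A.map List.ofFn) (P.map List.ofFn) (List.ofFn q) =
      ((spreadSet X P)^[P.length] [q]).map List.ofFn := by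
  rw [component, List.foldl_const, List.length_map]
  generalize P.length = n
  induction n with
  | zero => rfl
  | succ n ih => rw [Function.iterate_succ_apply', Function.iterate_succ_apply', ih, spread_map hA]

/-- The iterates form an increasing chain of subsets of `P`, which is constant from the first
repetition on. Hence `P.length` rounds suffice. The claim concerns membership only, since the lists
themselves may differ in order. -/
theorem spreadSet_fixed {P : List (Fin d → ℕ)} {q : Fin d → ℕ} (hq : q ∈ P) (hP : ∀ p ∈ P, p ∈ X)
    (p : Fin d → ℕ) (hp : p ∈ spreadSet X P ((spreadSet X P)^[P.length] [q])) :
    p ∈ (spreadSet X P)^[P.length] [q] := by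
  set s : ℕ → Finset (Fin d → ℕ) := fun n => ((spreadSet X P)^[n] [q]).toFinset with hs
  have mem : ∀ n p, p ∈ s (n + 1) ↔ p ∈ P ∧ ∃ r ∈ s n, p ⊔ r ∈ X := by
    intro n p
    simp only [hs, List.mem_toFinset, Function.iterate_succ_apply', mem_spreadSet]
  have sub : ∀ n, s n ⊆ P.toFinset := by
    rintro (_ | n) p hp
    · simp only [hs, Function.iterate_zero, id, List.mem_toFinset, List.mem_singleton] at hp ⊢
      rwa [hp]
    · exact List.mem_toFinset.2 ((mem n p).1 hp).1
  have mono : ∀ n, s n ⊆ s (n + 1) := by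
    intro n p hp
    have hpP := List.mem_toFinset.1 (sub n hp)
    -- Every vertex is adjacent to itself, as `p ⊔ p = p` lies in `X`.
    exact (mem n p).2 ⟨hpP, p, hp, by simpa using hP p hpP⟩
  have stab : ∀ n, P.toFinset.card ≤ n → (s n).card = (s P.toFinset.card).card := fun n =>
    Nat.stabilises_of_monotone (f := fun n => (s n).card) (monotone_nat_of_le_succ fun n => Finset.card_le_card (mono n))
    (fun n => Finset.card_le_card (sub n)) (fun n hn => by
      have := Finset.eq_of_subset_of_card_le (mono n) hn.ge
      congr 1
      ext p
      rw [mem, mem, ← this])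
  have hlen := P.toFinset_card_le
  have heq : s P.length = s (P.length + 1) :=
    Finset.eq_of_subset_of_card_le (mono _) ((stab _ (hlen.trans (Nat.le_succ _))).trans
      (stab _ hlen).symm).le
  have : p ∈ s (P.length + 1) := by
    simpa only [hs, List.mem_toFinset, Function.iterate_succ_apply'] using hp
  rw [← heq] at this
  exact List.mem_toFinset.1 this

theorem mem_iterate_spreadSet {P : List (Fin d → ℕ)} {q : Fin d → ℕ} (hq : q ∈ P)
    (hP : ∀ p ∈ P, p ∈ X) (n : ℕ) : q ∈ (spreadSet X P)^[n] [q] := by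
  induction n with
  | zero => simp
  | succ n ih =>
    rw [Function.iterate_succ_apply', mem_spreadSet]
    exact ⟨hq, q, ih, by simpa using hP q hq⟩

theorem iterate_spreadSet_induction {P : List (Fin d → ℕ)} {q : Fin d → ℕ}
    {Z : (Fin d → ℕ) → Prop} (hq : Z q) (hZ : ∀ p ∈ P, ∀ r, Z r → p ⊔ r ∈ X → Z p) (n : ℕ) :
    ∀ p ∈ (spreadSet X P)^[n] [q], Z p := by
  induction n with
  | zero => simpa using hq
  | succ n ih =>
    intro p hp
    rw [Function.iterate_succ_apply', mem_spreadSet] at hp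
    obtain ⟨hpP, r, hr, hpr⟩ := hp
    exact hZ p hpP r (ih r hr) hpr

/-- The moves in terms of vectors. -/
theorem moves_map (hA : Generates A X) (B : List (Fin d → ℕ)) :
    moves (A.map List.ofFn) (B.map List.ofFn) =
      (B.filter fun q => decide (q ∈ X)).map fun q =>
        exchange (A.map List.ofFn) (B.map List.ofFn)
          (((spreadSet X (B.filter fun q => decide (q ∈ X)))^[(B.filter fun q =>
            decide (q ∈ X)).length] [q]).map List.ofFn) := by
  have : ((B.map List.ofFn).filter fun q => !above (A.map List.ofFn) q) =
      (B.filter fun q => decide (q ∈ X)).map List.ofFn := by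
    rw [List.filter_map]
    congr 1
    refine List.filter_congr fun q _ => ?_
    rw [Function.comp, Bool.eq_iff_iff, Bool.not_eq_true', ← Bool.not_eq_true, above_map,
      ← hA, not_not, decide_eq_true_iff]
  rw [moves, this, List.map_map]
  refine List.map_congr_left fun q _ => ?_
  rw [Function.comp, component_map hA]

theorem exchange_map (hA : Generates A X) (hB : Generates B Y) (hQB : ∀ q ∈ Q, q ∈ B)
    (hQ : ∀ q ∈ Q, ∀ p ∈ B, q ⊔ p ∈ X → p ∈ Q) :
    IsCornerList (X \ upperPart X Q)
        (exchange (A.map List.ofFn) (B.map List.ofFn) (Q.map List.ofFn)).1 ∧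
      IsCornerList (Y ∪ upperPart X Q)
        (exchange (A.map List.ofFn) (B.map List.ofFn) (Q.map List.ofFn)).2 := by
  have h1 := isCornerList_minimals (generates_sdiff (Q := Q) hA)
  have h2 := isCornerList_minimals (generates_union hA hB hQB hQ)
  rw [List.map_append] at h1 h2
  refine ⟨h1, ?_⟩
  rw [exchange]
  convert h2 using 3
  · rw [List.filter_map]
    congr 1
    refine List.filter_congr fun r _ => ?_
    rw [Function.comp, List.any_map]
    congr 1
    rw [Bool.eq_iff_iff]
    simp [veq_ofFn]
  · rw [List.flatMap_map, List.map_flatMap]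
    congr 1
    funext p
    simp [vsup_ofFn, Function.comp_def]

theorem movable_upperPart (hA : Generates A X) (hB : Generates B Y) (hQB : ∀ q ∈ Q, q ∈ B)
    (hQX : ∀ q ∈ Q, q ∈ X) (hne : ∃ q, q ∈ Q)
    (hQ : ∀ q ∈ Q, ∀ p ∈ B, q ⊔ p ∈ X → p ∈ Q) : Movable X Y (upperPart X Q) where
  nonempty := by
    obtain ⟨q, hq⟩ := hne
    exact ⟨q, mem_upperPart.2 ⟨hQX q hq, q, hq, le_rfl⟩⟩
  subset x hx := by
    obtain ⟨hx, q, hq, hqx⟩ := mem_upperPart.1 hx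
    exact Finset.mem_sdiff.2 ⟨hx, (hB x).2 ⟨q, hQB q hq, hqx⟩⟩
  sdiff := (generates_sdiff hA).isStandard
  union := (generates_union hA hB hQB hQ).isStandard

/-- Soundness needs only that the computed component is closed under adjacency, hence movable;
whether it is an atom plays no role. -/
theorem exists_movable_of_mem_moves {G G' : List (List ℕ)} (hX : IsStandard X)
    (hG : IsCornerList X G) (hY : IsStandard Y) (hG' : IsCornerList Y G')
    {z : List (List ℕ) × List (List ℕ)} (hz : z ∈ moves G G') :
    ∃ K, Movable X Y K ∧ IsCornerList (X \ K) z.1 ∧ IsCornerList (Y ∪ K) z.2 := by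
  obtain ⟨A, rfl, hA, -⟩ := hG.exists_generates hX
  obtain ⟨B, rfl, hB, -⟩ := hG'.exists_generates hY
  rw [moves_map hA B] at hz
  set P := B.filter fun q => decide (q ∈ X) with hPdef
  have hP : ∀ p, p ∈ P ↔ p ∈ B ∧ p ∈ X := by simp [hPdef]
  obtain ⟨q, hq, rfl⟩ := List.mem_map.1 hz
  have hsub : ∀ p ∈ (spreadSet X P)^[P.length] [q], p ∈ P :=
    iterate_spreadSet_induction hq (fun p hp _ _ _ => hp) _
  have hcl : ∀ r ∈ (spreadSet X P)^[P.length] [q], ∀ p ∈ B, r ⊔ p ∈ X →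
      p ∈ (spreadSet X P)^[P.length] [q] := by
    intro r hr p hp hrp
    refine spreadSet_fixed hq (fun p hp => ((hP p).1 hp).2) p (mem_spreadSet.2 ⟨(hP p).2 ⟨hp,
      hA.isStandard.mem_of_le le_sup_right hrp⟩, r, hr, by rwa [sup_comm]⟩)
  refine ⟨_, movable_upperPart hA hB (fun p hp => ((hP p).1 (hsub p hp)).1)
    (fun p hp => ((hP p).1 (hsub p hp)).2)
    ⟨q, mem_iterate_spreadSet hq (fun p hp => ((hP p).1 hp).2) _⟩ hcl,
    exchange_map hA hB (fun p hp => ((hP p).1 (hsub p hp)).1) hcl⟩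

/-- Below a point of `K` there is a corner `q` of `Y`, and `q ∈ K`. The component of `q` cannot
leave `K`: if `r ∈ K` and `p ⊔ r ∈ X`, then `p ⊔ r ∈ K` because `X \ K` is standard, and then `p ∈
K` because `Y ∪ K` is standard and `p ∉ Y`. The part of `X` above the component is thus a movable
subset of `K`, and by minimality it is `K`. -/
theorem exists_mem_moves_of_isAtom {G G' : List (List ℕ)} (hX : IsStandard X)
    (hG : IsCornerList X G) (hY : IsStandard Y) (hG' : IsCornerList Y G') (hK : IsAtom X Y K) :
    ∃ z ∈ moves G G', IsCornerList (X \ K) z.1 ∧ IsCornerList (Y ∪ K) z.2 := by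
  obtain ⟨A, rfl, hA, -⟩ := hG.exists_generates hX
  obtain ⟨B, rfl, hB, hBc⟩ := hG'.exists_generates hY
  rw [moves_map hA B]
  set P := B.filter fun q => decide (q ∈ X) with hPdef
  have hP : ∀ p, p ∈ P ↔ p ∈ B ∧ p ∈ X := by simp [hPdef]
  obtain ⟨⟨⟨x, hx⟩, hKs, hK1, hK2⟩, hKmin⟩ := hK
  have hKX : ∀ y ∈ K, y ∈ X := fun y hy => (Finset.mem_sdiff.1 (hKs hy)).1
  have hKY : ∀ y ∈ K, y ∉ Y := fun y hy => (Finset.mem_sdiff.1 (hKs hy)).2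
  have hdown : ∀ y ∈ K, ∀ z, z ≤ y → z ∉ Y → z ∈ K := fun y hy z hzy hz =>
    (Finset.mem_union.1 (hK2.mem_of_le hzy (Finset.mem_union_right _ hy))).resolve_left hz
  have hup : ∀ y ∈ K, ∀ z, y ≤ z → z ∈ X → z ∈ K := fun y hy z hyz hz => by
    by_contra hzK
    exact (Finset.mem_sdiff.1 (hK1.mem_of_le hyz (Finset.mem_sdiff.2 ⟨hz, hzK⟩))).2 hy
  obtain ⟨q, hqB, hqx⟩ := (hB x).1 (hKY x hx)
  have hBY : ∀ b ∈ B, b ∉ Y := fun b hb => (hB b).2 ⟨b, hb, le_rfl⟩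
  have hqK : q ∈ K := hdown x hx q hqx (hBY q hqB)
  have hq : q ∈ P := (hP q).2 ⟨hqB, hKX q hqK⟩
  have hsub : ∀ p ∈ (spreadSet X P)^[P.length] [q], p ∈ P :=
    iterate_spreadSet_induction hq (fun p hp _ _ _ => hp) _
  have hsubK : ∀ p ∈ (spreadSet X P)^[P.length] [q], p ∈ K := by
    refine iterate_spreadSet_induction hqK (fun p hp r hr hpr => ?_) _
    exact hdown _ (hup r hr _ le_sup_right hpr) p le_sup_left (hBY p ((hP p).1 hp).1)
  have hcl : ∀ r ∈ (spreadSet X P)^[P.length] [q], ∀ p ∈ B, r ⊔ p ∈ X →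
      p ∈ (spreadSet X P)^[P.length] [q] := by
    intro r hr p hp hrp
    refine spreadSet_fixed hq (fun p hp => ((hP p).1 hp).2) p (mem_spreadSet.2 ⟨(hP p).2 ⟨hp,
      hA.isStandard.mem_of_le le_sup_right hrp⟩, r, hr, by rwa [sup_comm]⟩)
  have hmov := movable_upperPart hA hB (fun p hp => ((hP p).1 (hsub p hp)).1)
    (fun p hp => ((hP p).1 (hsub p hp)).2)
    ⟨q, mem_iterate_spreadSet hq (fun p hp => ((hP p).1 hp).2) _⟩ hcl
  have heq := hKmin _ (fun y hy => by
    obtain ⟨hyX, r, hr, hry⟩ := mem_upperPart.1 hy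
    exact hup r (hsubK r hr) y hry hyX) hmov
  have := exchange_map hA hB (fun p hp => ((hP p).1 (hsub p hp)).1) hcl
  rw [heq] at this
  exact ⟨_, List.mem_map.2 ⟨q, hq, rfl⟩, this⟩

/-! ### Existence and reversibility of atoms -/

theorem exists_isAtom (hX : IsStandard X) (hY : IsStandard Y) (h : ¬ X ⊆ Y) :
    ∃ K, IsAtom X Y K := by
  -- Moving the whole difference yields `X ∩ Y` and `X ∪ Y`; a minimal movable subset of it is an
  -- atom.
  have h1 : Movable X Y (X \ Y) := by
    refine ⟨by rwa [Finset.sdiff_nonempty], subset_rfl, ?_, ?_⟩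
    · refine isStandard_of_forall fun x y hxy hy => ?_
      simp only [Finset.mem_sdiff, not_and, not_not] at hy ⊢
      exact ⟨hX.mem_of_le hxy hy.1, fun _ => hY.mem_of_le hxy (hy.2 hy.1)⟩
    · refine isStandard_of_forall fun x y hxy hy => ?_
      simp only [Finset.union_sdiff_self_eq_union, Finset.mem_union] at hy ⊢
      exact hy.imp (hY.mem_of_le hxy) (hX.mem_of_le hxy)
  obtain ⟨K, -, hK⟩ := exists_minimal_le_of_wellFoundedLT (Movable X Y) _ h1
  exact ⟨K, hK.1, fun K' hK' hm => hK'.antisymm (hK.2 hm hK')⟩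

/-- An atom can be moved back. -/
theorem IsAtom.reverse (hX : IsStandard X) (hY : IsStandard Y) (h : IsAtom X Y K) :
    IsAtom (Y ∪ K) (X \ K) K ∧ (Y ∪ K) \ K = Y ∧ (X \ K) ∪ K = X := by
  obtain ⟨⟨hne, hs, h1, h2⟩, hmin⟩ := h
  have hKX : ∀ y ∈ K, y ∈ X := fun y hy => (Finset.mem_sdiff.1 (hs hy)).1
  have hKY : ∀ y ∈ K, y ∉ Y := fun y hy => (Finset.mem_sdiff.1 (hs hy)).2
  have e1 : (Y ∪ K) \ K = Y := by
    ext x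
    have := hKY x
    simp only [Finset.mem_sdiff, Finset.mem_union]
    tauto
  have e2 : (X \ K) ∪ K = X := by
    ext x
    have := hKX x
    simp only [Finset.mem_sdiff, Finset.mem_union]
    tauto
  refine ⟨⟨⟨hne, fun x hx => ?_, by rwa [e1], by rwa [e2]⟩, fun K' hK' hm => ?_⟩, e1, e2⟩
  · simp [hx]
  · by_contra hne'
    have e3 : (Y ∪ K) \ K' = Y ∪ (K \ K') := by
      ext x
      have := hKY x
      have := @hK' x
      simp only [Finset.mem_sdiff, Finset.mem_union]
      tauto
    have e4 : X \ K ∪ K' = X \ (K \ K') := by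
      ext x
      have := hKX x
      have := @hK' x
      simp only [Finset.mem_sdiff, Finset.mem_union]
      tauto
    -- Moving `K` forward and `K'` back amounts to moving `K \ K'` forward, so a proper movable part
    -- `K'` of the way back would contradict the minimality of `K`.
    have h3 : Movable X Y (K \ K') := by
      refine ⟨?_, Finset.sdiff_subset.trans hs, e4 ▸ hm.union, e3 ▸ hm.sdiff⟩
      rw [Finset.sdiff_nonempty]
      exact fun h => hne' (hK'.antisymm h)
    have h4 := hmin _ Finset.sdiff_subset h3
    obtain ⟨x, hx⟩ := hm.nonempty
    have h5 := hK' hx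
    rw [← h4] at h5
    exact (Finset.mem_sdiff.1 h5).2 hx

end generators

/-! ### Connect Four decompositions -/

section decompositions

variable {d : ℕ} {Δ : Finset (Fin (d + 1) → ℕ)} {X Y K : Finset (Fin d → ℕ)}
  {M R : Multiset (Finset (Fin d → ℕ))}

/-- The point `(γ, b)`. -/
def point (γ : Fin d → ℕ) (b : ℕ) : Fin (d + 1) → ℕ := Fin.snoc (α := fun _ => ℕ) γ b

@[simp] theorem point_castSucc (γ : Fin d → ℕ) (b : ℕ) (i : Fin d) :
    point γ b i.castSucc = γ i := by simp [point]

@[simp] theorem point_last (γ : Fin d → ℕ) (b : ℕ) : point γ b (Fin.last d) = b := by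
  simp [point]

theorem point_eta (β : Fin (d + 1) → ℕ) : point (fun i => β i.castSucc) (β (Fin.last d)) = β :=
  Fin.snoc_init_self β

theorem le_point_iff {β : Fin (d + 1) → ℕ} {γ : Fin d → ℕ} {b : ℕ} :
    β ≤ point γ b ↔ (fun i => β i.castSucc) ≤ γ ∧ β (Fin.last d) ≤ b := by
  simp [Pi.le_def, Fin.forall_fin_succ', point]

theorem point_le_point {γ δ : Fin d → ℕ} {a b : ℕ} : point γ a ≤ point δ b ↔ γ ≤ δ ∧ a ≤ b := by
  simp [le_point_iff]

theorem height_embed (Γ : Finset (Fin d → ℕ)) (γ : Fin d → ℕ) :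
    height (embed Γ) γ = if γ ∈ Γ then 1 else 0 := by
  have : (embed Γ).filter (fun β => (fun i : Fin d => β i.castSucc) = γ) =
      if γ ∈ Γ then {point γ 0} else ∅ := by
    ext β
    simp only [embed, Finset.mem_filter, Finset.mem_image]
    constructor
    · rintro ⟨⟨δ, hδ, rfl⟩, rfl⟩
      simp [hδ, point]
    · split_ifs with h
      · intro hβ
        obtain rfl := Finset.mem_singleton.1 hβ
        exact ⟨⟨γ, h, rfl⟩, by simp⟩
      · simp
  rw [height, this]
  split_ifs <;> simp

/-- An embedded set has height `1` over its elements and `0` elsewhere, so the sum of the heights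
over `γ` counts the members that contain `γ`. -/
theorem isC4Decomposition_iff : IsC4Decomposition Δ M ↔ (∀ Γ ∈ M, IsStandard Γ ∧ Γ.Nonempty) ∧
    ∀ γ b, b < M.countP (γ ∈ ·) ↔ point γ b ∈ Δ := by
  have hsum : ∀ γ : Fin d → ℕ, ((M.map embed).map fun Γ => height Γ γ).sum =
      M.countP (γ ∈ ·) := by
    intro γ
    rw [Multiset.map_map]
    induction M using Multiset.induction_on with
    | empty => simp
    | cons Γ M ih =>
      rw [Multiset.map_cons, Multiset.sum_cons, ih, Multiset.countP_cons, Function.comp,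
        height_embed, add_comm]
  refine and_congr_right fun _ => ?_
  rw [Set.ext_iff]
  simp only [c4Sum, Set.mem_ofPred_eq, hsum, Finset.mem_coe]
  constructor
  · intro h γ b
    simpa using h (point γ b)
  · intro h β
    simpa only [point_eta] using h (fun i => β i.castSucc) (β (Fin.last d))

/-- Each point of `K` is lost by one member and gained by another. The set `X \ K` remains nonempty
because `0` belongs to both `X` and `Y`, hence not to `K`. -/
theorem IsC4Decomposition.move (h : IsC4Decomposition Δ (X ::ₘ Y ::ₘ R)) (hK : Movable X Y K) :
    IsC4Decomposition Δ ((X \ K) ::ₘ (Y ∪ K) ::ₘ R) := by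
  rw [isC4Decomposition_iff] at h ⊢
  obtain ⟨h1, h2⟩ := h
  have hX := h1 X (by simp)
  have hY := h1 Y (by simp)
  refine ⟨?_, fun γ b => ?_⟩
  · intro Γ hΓ
    simp only [Multiset.mem_cons] at hΓ
    rcases hΓ with rfl | rfl | hΓ
    · refine ⟨hK.sdiff, 0, Finset.mem_sdiff.2 ⟨hX.1.zero_mem hX.2, fun h0 => ?_⟩⟩
      exact (Finset.mem_sdiff.1 (hK.subset h0)).2 (hY.1.zero_mem hY.2)
    · exact ⟨hK.union, hY.2.mono Finset.subset_union_left⟩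
    · exact h1 Γ (by simp [hΓ])
  · rw [← h2]
    have h3 : γ ∈ K → γ ∈ X \ Y := fun h => hK.subset h
    simp only [Finset.mem_sdiff] at h3
    simp only [Multiset.countP_cons, Finset.mem_sdiff, Finset.mem_union]
    by_cases hγ : γ ∈ K
    · simp [hγ, h3 hγ]
    · simp [hγ]

/-- The layer of `Δ` at height `k`. -/
def layerSet (Δ : Finset (Fin (d + 1) → ℕ)) (k : ℕ) : Finset (Fin d → ℕ) :=
  (Δ.image fun β i => β (Fin.castSucc i)).filter fun γ => point γ k ∈ Δ

theorem mem_layerSet {k : ℕ} {γ : Fin d → ℕ} : γ ∈ layerSet Δ k ↔ point γ k ∈ Δ := by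
  simp only [layerSet, Finset.mem_filter, Finset.mem_image, and_iff_right_iff_imp]
  exact fun h => ⟨_, h, by simp⟩

/-- In a decreasing list the members that contain `γ` form an initial segment, so a chain can be
recovered from its counts. -/
theorem mem_getElem_iff {l : List (Finset (Fin d → ℕ))} (hl : l.Pairwise fun X Y => Y ⊆ X)
    (γ : Fin d → ℕ) (j : ℕ) (hj : j < l.length) : γ ∈ l[j] ↔ j < l.countP (γ ∈ ·) := by
  induction l generalizing j with
  | nil => simp at hj
  | cons X l ih =>
    rw [List.pairwise_cons] at hl
    rw [List.countP_cons]
    rcases j with _ | j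
    · by_cases hX : γ ∈ X
      · simp [hX]
      · have : l.countP (γ ∈ ·) = 0 := by
          rw [List.countP_eq_zero]
          intro Y hY
          simpa using fun h => hX (hl.1 Y hY h)
        simp [hX, this]
    · simp only [List.length_cons, Nat.add_lt_add_iff_right] at hj
      rw [List.getElem_cons_succ, ih hl.2 j hj]
      by_cases hX : γ ∈ X
      · simp [hX]
      · have : l.countP (γ ∈ ·) = 0 := by
          rw [List.countP_eq_zero]
          intro Y hY
          simpa using fun h => hX (hl.1 Y hY h)
        simp [hX, this]

theorem pairwise_layerSet (hΔ : IsStandard Δ) (n : ℕ) :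
    ((List.range n).map (layerSet Δ)).Pairwise fun X Y => Y ⊆ X := by
  rw [List.pairwise_map]
  refine List.pairwise_lt_range.imp fun {a b} hab γ hγ => ?_
  rw [mem_layerSet] at hγ ⊢
  exact hΔ.mem_of_le (point_le_point.2 ⟨le_rfl, hab.le⟩) hγ

theorem isC4Decomposition_layerSet (hΔ : IsStandard Δ) {n : ℕ}
    (hn : ∀ j, j < n ↔ point 0 j ∈ Δ) :
    IsC4Decomposition Δ ((List.range n).map (layerSet Δ) : List (Finset (Fin d → ℕ))) := by
  rw [isC4Decomposition_iff]
  constructor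
  · intro Γ hΓ
    obtain ⟨j, hj, rfl⟩ := List.mem_map.1 (Multiset.mem_coe.1 hΓ)
    refine ⟨isStandard_of_forall fun x y hxy hy => ?_, 0, ?_⟩
    · rw [mem_layerSet] at hy ⊢
      exact hΔ.mem_of_le (point_le_point.2 ⟨hxy, le_rfl⟩) hy
    · rw [mem_layerSet, ← hn]
      exact List.mem_range.1 hj
  · intro γ b
    rw [Multiset.coe_countP]
    by_cases hb : b < n
    · have := mem_getElem_iff (pairwise_layerSet hΔ n) γ b (by simpa using hb)
      rw [← this, List.getElem_map, List.getElem_range, mem_layerSet]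
    · refine iff_of_false (fun h => hb (h.trans_le ?_)) fun h => hb ((hn b).2 ?_)
      · refine List.countP_le_length.trans (by simp)
      · exact hΔ.mem_of_le (point_le_point.2 ⟨Pi.le_def.2 fun _ => Nat.zero_le _, le_rfl⟩) h

/-- All members contain `0`, so the count at `0` fixes the length; the other counts then fix each
member of the chain. -/
theorem eq_layerSet_of_pairwise {n : ℕ} (hn : ∀ j, j < n ↔ point 0 j ∈ Δ)
    {l : List (Finset (Fin d → ℕ))} (hl : l.Pairwise fun X Y => Y ⊆ X)
    (h : IsC4Decomposition Δ (l : Multiset (Finset (Fin d → ℕ)))) :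
    l = (List.range n).map (layerSet Δ) := by
  rw [isC4Decomposition_iff] at h
  simp only [Multiset.coe_countP, Multiset.mem_coe] at h
  obtain ⟨h1, h2⟩ := h
  have hlen : l.length = n := by
    have h3 : l.countP ((0 : Fin d → ℕ) ∈ ·) = l.length := by
      rw [List.countP_eq_length]
      intro Γ hΓ
      simpa using (h1 Γ hΓ).1.zero_mem (h1 Γ hΓ).2
    refine eq_of_forall_lt_iff fun j => ?_
    rw [hn, ← h2, h3]
  refine List.ext_getElem (by simpa using hlen) fun j hj hj' => ?_
  rw [List.getElem_map, List.getElem_range]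
  ext γ
  rw [mem_getElem_iff hl, mem_layerSet, ← h2]

/-- Sort by decreasing cardinality: either the sorted list is a chain, or two of its members violate
inclusion, with the larger one first. -/
theorem exists_not_subset_or_pairwise (l : List (Finset (Fin d → ℕ))) :
    (∃ X Y R, l.Perm (X :: Y :: R) ∧ Y.card ≤ X.card ∧ ¬ Y ⊆ X) ∨
      ∃ m : List (Finset (Fin d → ℕ)), l.Perm m ∧ m.Pairwise fun X Y => Y ⊆ X := by
  let r : Finset (Fin d → ℕ) → Finset (Fin d → ℕ) → Prop := fun X Y => Y.card ≤ X.card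
  have : Std.Total r := ⟨fun X Y => Nat.le_total _ _⟩
  have : IsTrans _ r := ⟨fun X Y Z h h' => Nat.le_trans h' h⟩
  have : DecidableRel r := fun X Y => inferInstanceAs (Decidable (Y.card ≤ X.card))
  have hp := List.pairwise_insertionSort r l
  have hperm := (List.perm_insertionSort r l).symm
  by_cases h : (l.insertionSort r).Pairwise fun X Y => Y ⊆ X
  · exact .inr ⟨_, hperm, h⟩
  · rw [List.pairwise_iff_forall_sublist] at h hp
    push Not at h
    obtain ⟨X, Y, hs, hYX⟩ := h
    obtain ⟨R, hR⟩ := hs.exists_perm_append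
    exact .inl ⟨X, Y, R, hperm.trans hR, hp hs, hYX⟩

/-- Guarantees that the truncated difference used as induction measure is a true difference. -/
theorem sum_card_sq_le (M : Multiset (Finset (Fin d → ℕ))) :
    (M.map fun X => X.card ^ 2).sum ≤ (M.map fun X => X.card).sum ^ 2 := by
  induction M using Multiset.induction_on with
  | empty => simp
  | cons X M ih =>
    simp only [Multiset.map_cons, Multiset.sum_cons]
    have := Nat.zero_le (X.card * (M.map fun X => X.card).sum)
    linarith [add_sq X.card (M.map fun X => X.card).sum]

/-- All decompositions can be reached from the decomposition into layers by moving atoms. -/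
theorem mem_of_closed_under_moves {n : ℕ} (hn : ∀ j, j < n ↔ point 0 j ∈ Δ)
    (V : Set (Multiset (Finset (Fin d → ℕ))))
    (h0 : (((List.range n).map (layerSet Δ) : List (Finset (Fin d → ℕ))) :
      Multiset (Finset (Fin d → ℕ))) ∈ V)
    (hV : ∀ X Y K R, IsC4Decomposition Δ (X ::ₘ Y ::ₘ R) → X ::ₘ Y ::ₘ R ∈ V → IsAtom X Y K →
      (X \ K) ::ₘ (Y ∪ K) ::ₘ R ∈ V)
    (hM : IsC4Decomposition Δ M) : M ∈ V := by
  -- The total cardinality is invariant under moves, so the measure decreases exactly when the sum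
  -- of squares grows.
  induction hk : (M.map fun X => X.card).sum ^ 2 - (M.map fun X => X.card ^ 2).sum using
    Nat.strong_induction_on generalizing M with
  | _ k ih =>
    subst hk
    obtain ⟨l, rfl⟩ := Quot.exists_rep M
    change IsC4Decomposition Δ (l : Multiset (Finset (Fin d → ℕ))) at hM
    change (l : Multiset (Finset (Fin d → ℕ))) ∈ V
    rcases exists_not_subset_or_pairwise l with ⟨X, Y, R, hl, hcard, hYX⟩ | ⟨m, hm, hp⟩
    · have hl' : (l : Multiset (Finset (Fin d → ℕ))) = Y ::ₘ X ::ₘ (R : Multiset _) := by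
        rw [Multiset.cons_coe, Multiset.cons_coe, Multiset.coe_eq_coe]
        exact hl.trans (.swap _ _ _)
      change ∀ m < ((l : Multiset (Finset (Fin d → ℕ))).map fun X => X.card).sum ^ 2 -
        ((l : Multiset (Finset (Fin d → ℕ))).map fun X => X.card ^ 2).sum, _ at ih
      rw [hl'] at hM ih ⊢
      have hstd := (isC4Decomposition_iff.1 hM).1
      have hX := (hstd X (by simp)).1
      have hY := (hstd Y (by simp)).1
      obtain ⟨K, hK⟩ := exists_isAtom hY hX hYX
      have hM' := hM.move hK.1
      obtain ⟨hrev, e1, e2⟩ := hK.reverse hY hX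
      rw [Multiset.cons_swap] at hM'
      have hmem := ih _ ?_ hM' rfl
      · have := hV _ _ _ _ hM' hmem hrev
        rwa [e1, e2, Multiset.cons_swap] at this
      · have hbound := sum_card_sq_le ((X ∪ K) ::ₘ (Y \ K) ::ₘ (R : Multiset (Finset (Fin d → ℕ))))
        have hKY : K ⊆ Y := hK.1.subset.trans Finset.sdiff_subset
        have c1 : (X ∪ K).card = X.card + K.card :=
          Finset.card_union_of_disjoint (Finset.disjoint_left.2 fun x hx hxK =>
            (Finset.mem_sdiff.1 (hK.1.subset hxK)).2 hx)
        have c2 : (Y \ K).card + K.card = Y.card := Finset.card_sdiff_add_card_eq_card hKY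
        have c3 : 0 < K.card := hK.1.nonempty.card_pos
        simp only [Multiset.map_cons, Multiset.sum_cons] at hbound ⊢
        rw [c1] at hbound ⊢
        rw [← c2] at hcard ⊢
        have e3 : X.card + K.card + ((Y \ K).card +
            ((R : Multiset (Finset (Fin d → ℕ))).map fun X => X.card).sum) =
            (Y \ K).card + K.card + (X.card +
              ((R : Multiset (Finset (Fin d → ℕ))).map fun X => X.card).sum) := by ring
        rw [e3] at hbound ⊢
        -- The sum of squares grows by `2 * |K| * (|X| - |Y \ K|)`, which is positive since `|Y \ K|
        -- < |Y| ≤ |X|`.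
        refine Nat.sub_lt_sub_left (lt_of_lt_of_le ?_ hbound) ?_ <;> nlinarith
    · have := eq_layerSet_of_pairwise hn hp (by rwa [Multiset.coe_eq_coe.2 hm.symm])
      rwa [Multiset.coe_eq_coe.2 hm, this]

/-- Each member lies in the projection of `Δ`, and since all members contain `0`, their number is at
most the height of `Δ` over `0`. This serves only to show that the search stops; the quantitative
bound comes from the output. -/
theorem finite_setOf_isC4Decomposition (Δ : Finset (Fin (d + 1) → ℕ)) :
    {M : Multiset (Finset (Fin d → ℕ)) | IsC4Decomposition Δ M}.Finite := by
  let B : Finset (Fin d → ℕ) := Δ.image fun β i => β (Fin.castSucc i)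
  obtain ⟨n, hn⟩ : ∃ n, point (0 : Fin d → ℕ) n ∉ Δ := by
    by_contra! h
    refine Set.infinite_of_injective_forall_mem (s := (Δ : Set (Fin (d + 1) → ℕ)))
      (f := fun n => point (0 : Fin d → ℕ) n) (fun a b hab => ?_) h Δ.finite_toSet
    simpa using congrFun hab (Fin.last d)
  refine (Set.finite_Iic (n • B.powerset.val)).subset fun M hM => ?_
  rw [Set.mem_ofPred_eq, isC4Decomposition_iff] at hM
  obtain ⟨h1, h2⟩ := hM
  rw [Set.mem_Iic, Multiset.le_iff_count]
  intro Γ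
  by_cases hΓ : Γ ∈ M
  · have hB : Γ ∈ B.powerset := by
      refine Finset.mem_powerset.2 fun γ hγ => ?_
      have : point γ 0 ∈ Δ := (h2 γ 0).1 (Multiset.countP_pos.2 ⟨Γ, hΓ, hγ⟩)
      exact Finset.mem_image.2 ⟨_, this, by simp⟩
    rw [Multiset.count_nsmul, Multiset.count_eq_one_of_mem B.powerset.nodup hB, mul_one]
    have h3 : M.countP ((0 : Fin d → ℕ) ∈ ·) = M.card :=
      Multiset.countP_eq_card.2 fun Γ hΓ => (h1 Γ hΓ).1.zero_mem (h1 Γ hΓ).2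
    have h4 := mt (h2 0 n).1 hn
    rw [h3, not_lt] at h4
    exact (Multiset.count_le_card _ _).trans h4
  · simp [Multiset.count_eq_zero_of_notMem hΓ]

end decompositions

/-! ### Correctness of the algorithm -/

section correctness

variable {d : ℕ}

/-- The list consists of the outer corners of a standard set. -/
def Valid (d : ℕ) (G : List (List ℕ)) : Prop :=
  ∃ Γ : Finset (Fin d → ℕ), IsStandard Γ ∧ IsCornerList Γ G

open Classical in
/-- The standard set with the given outer corners. -/
noncomputable def den (d : ℕ) (G : List (List ℕ)) : Finset (Fin d → ℕ) :=
  if h : Valid d G then h.choose else ∅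

/-- The multiset of standard sets with the given outer corners. -/
noncomputable def mden (d : ℕ) (L : List (List (List ℕ))) : Multiset (Finset (Fin d → ℕ)) :=
  L.map (den d)

theorem Valid.spec {G : List (List ℕ)} (h : Valid d G) :
    IsStandard (den d G) ∧ IsCornerList (den d G) G := by
  rw [den, dif_pos h]
  exact h.choose_spec

theorem den_eq {Γ : Finset (Fin d → ℕ)} {G : List (List ℕ)} (hΓ : IsStandard Γ)
    (hG : IsCornerList Γ G) : den d G = Γ := by
  obtain ⟨h1, h2⟩ := Valid.spec ⟨Γ, hΓ, hG⟩
  exact (seteq_iff h1 h2 hΓ hG).1 ((seteq_iff hΓ hG hΓ hG).2 rfl)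

theorem seteq_iff_den {G G' : List (List ℕ)} (h : Valid d G) (h' : Valid d G') :
    seteq G G' = true ↔ den d G = den d G' :=
  seteq_iff h.spec.1 h.spec.2 h'.spec.1 h'.spec.2

theorem mult_eq {G : List (List ℕ)} {L : List (List (List ℕ))} (h : Valid d G)
    (hL : ∀ G ∈ L, Valid d G) : mult G L = (mden d L).count (den d G) := by
  rw [mden, Multiset.coe_count, List.count_eq_length_filter, List.filter_map, List.length_map,
    mult]
  congr 1
  refine List.filter_congr fun G' hG' => ?_
  rw [Bool.eq_iff_iff, seteq_iff_den h (hL G' hG'), Function.comp, beq_iff_eq, eq_comm]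

/-- It suffices to compare multiplicities at the sets that occur in one of the two lists, as all
others have multiplicity `0` in both. -/
theorem deceq_iff {L L' : List (List (List ℕ))} (hL : ∀ G ∈ L, Valid d G)
    (hL' : ∀ G ∈ L', Valid d G) : deceq L L' = true ↔ mden d L = mden d L' := by
  have h1 : deceq L L' = true ↔ ∀ G ∈ L ++ L', mult G L = mult G L' := by
    rw [deceq, List.all_eq_true]
    refine forall₂_congr fun G _ => ?_
    rw [Bool.and_eq_true, decide_eq_true_iff, decide_eq_true_iff, le_antisymm_iff]
  have h2 : ∀ G ∈ L ++ L', Valid d G := fun G hG => (List.mem_append.1 hG).elim (hL G) (hL' G)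
  rw [h1]
  constructor
  · intro h
    ext Γ
    by_cases hΓ : ∃ G ∈ L ++ L', den d G = Γ
    · obtain ⟨G, hG, rfl⟩ := hΓ
      rw [← mult_eq (h2 G hG) hL, ← mult_eq (h2 G hG) hL', h G hG]
    · push Not at hΓ
      rw [Multiset.count_eq_zero_of_notMem, Multiset.count_eq_zero_of_notMem] <;>
      · rw [mden, Multiset.mem_coe, List.mem_map]
        rintro ⟨G, hG, rfl⟩
        exact hΓ G (by simp [hG]) rfl
  · intro h G hG
    rw [mult_eq (h2 G hG) hL, mult_eq (h2 G hG) hL', h]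

variable {Δ : Finset (Fin (d + 1) → ℕ)}

/-- The list represents a decomposition of `Δ`. -/
def Represents (Δ : Finset (Fin (d + 1) → ℕ)) (L : List (List (List ℕ))) : Prop :=
  (∀ G ∈ L, Valid d G) ∧ IsC4Decomposition Δ (mden d L)

theorem mden_perm {L L' : List (List (List ℕ))} (h : L.Perm L') : mden d L = mden d L' :=
  Multiset.coe_eq_coe.2 (h.map _)

theorem mden_cons (G : List (List ℕ)) (L : List (List (List ℕ))) :
    mden d (G :: L) = den d G ::ₘ mden d L := rfl

theorem mem_neighbors {L N : List (List (List ℕ))} : N ∈ neighbors L ↔ ∃ x ∈ picks L,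
    ∃ y ∈ picks x.2, ∃ z ∈ moves x.1 y.1, z.1 :: z.2 :: y.2 = N := by
  simp only [neighbors, List.mem_flatMap, List.mem_map]

theorem Represents.neighbors {L N : List (List (List ℕ))} (h : Represents Δ L)
    (hN : N ∈ neighbors L) : Represents Δ N := by
  obtain ⟨x, hx, y, hy, z, hz, rfl⟩ := mem_neighbors.1 hN
  have hp : L.Perm (x.1 :: y.1 :: y.2) :=
    (PT.perm_of_mem_picks hx).trans ((PT.perm_of_mem_picks hy).cons _)
  obtain ⟨hv, hdec⟩ := h
  rw [mden_perm hp, mden_cons, mden_cons] at hdec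
  have hvx := (hv x.1 (hp.mem_iff.2 (by simp))).spec
  have hvy := (hv y.1 (hp.mem_iff.2 (by simp))).spec
  obtain ⟨K, hK, h1, h2⟩ := exists_movable_of_mem_moves hvx.1 hvx.2 hvy.1 hvy.2 hz
  refine ⟨fun G hG => ?_, ?_⟩
  · rcases List.mem_cons.1 hG with rfl | hG
    · exact ⟨_, hK.sdiff, h1⟩
    rcases List.mem_cons.1 hG with rfl | hG
    · exact ⟨_, hK.union, h2⟩
    · exact hv G (hp.mem_iff.2 (by simp [hG]))
  · rw [mden_cons, mden_cons, den_eq hK.sdiff h1, den_eq hK.union h2]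
    exact hdec.move hK

theorem exists_mem_picks {α : Type} {l : List α} {a : α} (h : a ∈ l) :
    ∃ y ∈ picks l, y.1 = a := by
  induction l with
  | nil => simp at h
  | cons x l ih =>
    rw [PT.picks_cons]
    rcases List.mem_cons.1 h with rfl | h
    · exact ⟨_, List.mem_cons_self, rfl⟩
    · obtain ⟨y, hy, rfl⟩ := ih h
      exact ⟨_, List.mem_cons_of_mem _ (List.mem_map_of_mem hy), rfl⟩

theorem exists_mem_picks_of_mden {L : List (List (List ℕ))} {X : Finset (Fin d → ℕ)}
    {R : Multiset (Finset (Fin d → ℕ))} (h : mden d L = X ::ₘ R) :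
    ∃ y ∈ picks L, den d y.1 = X ∧ mden d y.2 = R := by
  have hX : X ∈ mden d L := by rw [h]; simp
  obtain ⟨G, hG, rfl⟩ := List.mem_map.1 (Multiset.mem_coe.1 hX)
  obtain ⟨y, hy, rfl⟩ := exists_mem_picks hG
  refine ⟨y, hy, rfl, ?_⟩
  rw [mden_perm (PT.perm_of_mem_picks hy), mden_cons] at h
  exact (Multiset.cons_inj_right _).1 h

theorem exists_mem_neighbors {L : List (List (List ℕ))} {X Y K : Finset (Fin d → ℕ)}
    {R : Multiset (Finset (Fin d → ℕ))} (hL : ∀ G ∈ L, Valid d G)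
    (h : mden d L = X ::ₘ Y ::ₘ R) (hK : IsAtom X Y K) :
    ∃ N ∈ neighbors L, mden d N = (X \ K) ::ₘ (Y ∪ K) ::ₘ R := by
  obtain ⟨x, hx, rfl, hx'⟩ := exists_mem_picks_of_mden h
  obtain ⟨y, hy, rfl, rfl⟩ := exists_mem_picks_of_mden hx'
  have hp : L.Perm (x.1 :: y.1 :: y.2) :=
    (PT.perm_of_mem_picks hx).trans ((PT.perm_of_mem_picks hy).cons _)
  have hvx := (hL x.1 (hp.mem_iff.2 (by simp))).spec
  have hvy := (hL y.1 (hp.mem_iff.2 (by simp))).spec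
  obtain ⟨z, hz, h1, h2⟩ := exists_mem_moves_of_isAtom hvx.1 hvx.2 hvy.1 hvy.2 hK
  refine ⟨_, mem_neighbors.2 ⟨x, hx, y, hy, z, hz, rfl⟩, ?_⟩
  rw [mden_cons, mden_cons, den_eq hK.1.sdiff h1, den_eq hK.1.union h2]

/-- The members of the list represent different decompositions of `Δ`. -/
def Admissible (Δ : Finset (Fin (d + 1) → ℕ)) (S : List (List (List (List ℕ)))) : Prop :=
  (∀ L ∈ S, Represents Δ L) ∧ S.Pairwise fun L L' => deceq L L' = false

theorem Admissible.grow {S : List (List (List (List ℕ)))} (h : Admissible Δ S) :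
    Admissible Δ (grow S) := by
  refine ⟨fun L hL => ?_, pairwise_insertAll h.2⟩
  rcases mem_or_mem_of_mem_insertAll hL with hL | hL
  · obtain ⟨L', hL', hL⟩ := List.mem_flatMap.1 hL
    exact (h.1 L' hL').neighbors hL
  · exact h.1 L hL

theorem Admissible.nodup {S : List (List (List (List ℕ)))} (h : Admissible Δ S) :
    (S.map (mden d)).Nodup := by
  rw [List.Nodup, List.pairwise_map]
  refine h.2.imp_of_mem fun {L L'} hL hL' hne heq => ?_
  rw [(deceq_iff (h.1 L hL).1 (h.1 L' hL').1).2 heq] at hne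
  exact absurd hne (by simp)

/-- `S` is a suffix of `grow S`, so if the length does not increase, the two are equal and every
neighbor was already represented. -/
theorem Admissible.exists_of_not_growing {S : List (List (List (List ℕ)))}
    (h : Admissible Δ S) (hS : growing S = false) {L N : List (List (List ℕ))} (hL : L ∈ S)
    (hN : N ∈ neighbors L) : ∃ L' ∈ S, mden d L' = mden d N := by
  have hNr := (h.1 L hL).neighbors hN
  have hgrow : ConnectFour.grow S = S := by
    have hlen : (ConnectFour.grow S).length ≤ S.length := by
      simpa only [growing, Bool.not_eq_false', decide_eq_true_eq] using hS
    exact ((suffix_insertAll deceq (S.flatMap ConnectFour.neighbors) S).eq_of_length_le hlen).symm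
  obtain ⟨L', hL', heq⟩ := exists_mem_insertAll (r := deceq) (S := S)
    (l := S.flatMap ConnectFour.neighbors) (fun x hx => by
      obtain ⟨L, hL, hx⟩ := List.mem_flatMap.1 hx
      have := ((h.1 L hL).neighbors hx).1
      exact (deceq_iff this this).2 rfl) (List.mem_flatMap.2 ⟨L, hL, hN⟩)
  change L' ∈ ConnectFour.grow S at hL'
  rw [hgrow] at hL'
  exact ⟨L', hL', ((deceq_iff hNr.1 (h.1 L' hL').1).1 heq).symm⟩

theorem Admissible.complete {S : List (List (List (List ℕ)))} (h : Admissible Δ S)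
    (hS : growing S = false) {n : ℕ} (hn : ∀ j, j < n ↔ point 0 j ∈ Δ)
    {L₀ : List (List (List ℕ))} (h₀ : L₀ ∈ S) (hL₀ : mden d L₀ = (List.range n).map (layerSet Δ))
    {M : Multiset (Finset (Fin d → ℕ))} (hM : IsC4Decomposition Δ M) : ∃ L ∈ S, mden d L = M := by
  refine mem_of_closed_under_moves hn {M | ∃ L ∈ S, mden d L = M} ⟨L₀, h₀, hL₀⟩ ?_ hM
  rintro X Y K R - ⟨L, hL, hXY⟩ hK
  obtain ⟨N, hN, hN'⟩ := exists_mem_neighbors (h.1 L hL).1 hXY hK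
  obtain ⟨L', hL', heq⟩ := h.exists_of_not_growing hS hL hN
  exact ⟨L', hL', heq.trans hN'⟩

/-- Otherwise the lists of pairwise different decompositions would become arbitrarily long, although
there are only finitely many decompositions. -/
theorem exists_not_growing {S : List (List (List (List ℕ)))} (h : Admissible Δ S) :
    ∃ n, (∀ i < n, growing (grow^[i] S) = true) ∧ growing (grow^[n] S) = false := by
  have hadm : ∀ n, Admissible Δ (grow^[n] S) := by
    intro n
    induction n with
    | zero => exact h
    | succ n ih => rw [Function.iterate_succ_apply']; exact ih.grow
  have hex : ∃ n, growing (grow^[n] S) = false := by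
    by_contra! hne
    have hlen : ∀ n, n ≤ (grow^[n] S).length := by
      intro n
      induction n with
      | zero => simp
      | succ n ih =>
        have := hne n
        simp only [growing, ne_eq, Bool.not_eq_false', decide_eq_true_eq] at this
        rw [Function.iterate_succ_apply']
        omega
    have hfin := finite_setOf_isC4Decomposition Δ
    have hcard : ∀ n, (grow^[n] S).length ≤ hfin.toFinset.card := by
      intro n
      rw [← List.length_map (f := mden d), ← List.toFinset_card_of_nodup (hadm n).nodup]
      refine Finset.card_le_card fun M hM => ?_
      obtain ⟨L, hL, rfl⟩ := List.mem_map.1 (List.mem_toFinset.1 hM)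
      exact hfin.mem_toFinset.2 ((hadm n).1 L hL).2
    have h1 := hlen (hfin.toFinset.card + 1)
    have h2 := hcard (hfin.toFinset.card + 1)
    omega
  classical
  refine ⟨Nat.find hex, fun i hi => ?_, Nat.find_spec hex⟩
  simpa using Nat.find_min hex hi

/-! ### Correctness and size of the output -/

theorem getElem?_position {G : List (List ℕ)} {U : List (List (List ℕ))}
    (h : ∃ G' ∈ U, seteq G G' = true) : ∃ G', U[position G U]? = some G' ∧ seteq G G' = true := by
  induction U with
  | nil => simp at h
  | cons G' U ih =>
    rw [position, List.foldr_cons]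
    cases hG : seteq G G'
    · obtain ⟨G'', hG'', hs⟩ := ih (by
        obtain ⟨G'', hG'', hs⟩ := h
        rcases List.mem_cons.1 hG'' with rfl | hG''
        · simp [hG] at hs
        · exact ⟨G'', hG'', hs⟩)
      exact ⟨G'', by simpa [position] using hG'', hs⟩
    · exact ⟨G', by simp, hG⟩

theorem valid_of_mem_occurring {S : List (List (List (List ℕ)))} (h : Admissible Δ S)
    {G : List (List ℕ)} (hG : G ∈ occurring S) : ∃ L ∈ S, G ∈ L ∧ Valid d G := by
  have := mem_or_mem_of_mem_insertAll hG
  simp only [List.mem_flatMap, List.not_mem_nil, or_false] at this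
  obtain ⟨L, hL, hGL⟩ := this
  exact ⟨L, hL, hGL, (h.1 L hL).1 G hGL⟩

theorem exists_mem_occurring {S : List (List (List (List ℕ)))} (h : Admissible Δ S)
    {L : List (List (List ℕ))} (hL : L ∈ S) {G : List (List ℕ)} (hG : G ∈ L) :
    ∃ G' ∈ occurring S, seteq G G' = true := by
  refine exists_mem_insertAll (fun G hG => ?_) (List.mem_flatMap.2 ⟨L, hL, hG⟩)
  obtain ⟨L, hL, hG⟩ := List.mem_flatMap.1 hG
  have := (h.1 L hL).1 G hG
  exact (seteq_iff_den this this).2 rfl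

theorem isListOfC4Decompositions_report {S : List (List (List (List ℕ)))} (h : Admissible Δ S)
    (hS : ∀ M : Multiset (Finset (Fin d → ℕ)), IsC4Decomposition Δ M → ∃ L ∈ S, mden d L = M) :
    IsListOfC4Decompositions Δ (report S).1 (report S).2 := by
  refine ⟨(occurring S).map (den d), S.map (mden d), ?_, ?_, ?_, h.nodup, ?_, ?_⟩
  · rw [List.Nodup, List.pairwise_map]
    have : (occurring S).Pairwise fun x y => seteq x y = false := pairwise_insertAll .nil
    refine this.imp_of_mem fun {G G'} hG hG' hne heq => ?_
    obtain ⟨-, -, -, hv⟩ := valid_of_mem_occurring h hG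
    obtain ⟨-, -, -, hv'⟩ := valid_of_mem_occurring h hG'
    rw [(seteq_iff_den hv hv').2 heq] at hne
    exact absurd hne (by simp)
  · intro Γ
    rw [List.mem_map]
    constructor
    · rintro ⟨G, hG, rfl⟩
      obtain ⟨L, hL, hGL, -⟩ := valid_of_mem_occurring h hG
      exact ⟨_, (h.1 L hL).2, Multiset.mem_coe.2 (List.mem_map_of_mem hGL)⟩
    · rintro ⟨M, hM, hΓ⟩
      obtain ⟨L, hL, rfl⟩ := hS M hM
      obtain ⟨G, hG, rfl⟩ := List.mem_map.1 (Multiset.mem_coe.1 hΓ)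
      obtain ⟨G', hG', heq⟩ := exists_mem_occurring h hL hG
      obtain ⟨-, -, -, hv⟩ := valid_of_mem_occurring h hG'
      exact ⟨G', hG', ((seteq_iff_den ((h.1 L hL).1 G hG) hv).1 heq).symm⟩
  · rw [List.forall₂_map_left_iff, report]
    refine List.forall₂_same.2 fun G hG => ?_
    obtain ⟨-, -, -, hv⟩ := valid_of_mem_occurring h hG
    exact hv.spec.2
  · intro M
    rw [List.mem_map]
    constructor
    · rintro ⟨L, hL, rfl⟩
      exact (h.1 L hL).2
    · exact hS M
  · rw [report, List.forall₂_map_left_iff, List.forall₂_map_right_iff]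
    refine List.forall₂_same.2 fun L hL => ?_
    rw [mden, Multiset.map_coe, Multiset.map_coe, List.map_map, List.map_map]
    refine congrArg _ (List.map_congr_left fun G hG => ?_)
    obtain ⟨G', hG', heq⟩ := getElem?_position (exists_mem_occurring h hL hG)
    obtain ⟨-, -, -, hv⟩ := valid_of_mem_occurring h (List.mem_of_getElem? hG')
    rw [Function.comp, Function.comp, List.getElem?_map, hG', Option.map_some,
      (seteq_iff_den ((h.1 L hL).1 G hG) hv).1 heq]

/-- The search spells out every member of every decomposition, the output each set only once. Still,
the number of decompositions, the number of members of each and the size of each corner list are all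
at most the output size; the last holds because an equal set is listed there with permuted corners.
The bound is obtained by nesting these three estimates. -/
theorem sz_le_sz_report {S : List (List (List (List ℕ)))} (h : Admissible Δ S) :
    sz S ≤ 1 + sz (report S) * (1 + (1 + sz (report S) * (1 + sz (report S)))) := by
  have h1 : ∀ L ∈ S, L.length ≤ sz (report S) := by
    intro L hL
    have h2 := sz_mem (List.mem_map_of_mem (f := fun L => L.map fun G =>
      position G (occurring S)) hL)
    have h3 := length_le_sz (L.map fun G => position G (occurring S))
    simp only [List.length_map] at h3
    simp only [report, sz_prod]
    omega
  have h2 : ∀ L ∈ S, ∀ G ∈ L, sz G ≤ sz (report S) := by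
    intro L hL G hG
    obtain ⟨G', hG', heq⟩ := exists_mem_occurring h hL hG
    obtain ⟨-, -, -, hv'⟩ := valid_of_mem_occurring h hG'
    have hv := (h.1 L hL).1 G hG
    have h3 := hv.spec.2
    rw [(seteq_iff_den hv hv').1 heq] at h3
    rw [sz_perm (h3.perm hv'.spec.2)]
    have := sz_mem hG'
    simp only [report, sz_prod]
    omega
  have h3 : S.length ≤ sz (report S) := by
    have := length_le_sz (S.map fun L => L.map fun G => position G (occurring S))
    simp only [List.length_map] at this
    simp only [report, sz_prod]
    omega
  refine (sz_le_of_forall (s := 1 + sz (report S) * (1 + sz (report S))) fun L hL => ?_).trans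
    (Nat.add_le_add_left (Nat.mul_le_mul_right _ h3) 1)
  exact (sz_le_of_forall (h2 L hL)).trans (Nat.add_le_add_left (Nat.mul_le_mul_right _ (h1 L hL)) 1)

/-! ### The layers -/

theorem last_ofFn (α : Fin (d + 1) → ℕ) : last (List.ofFn α) = α (Fin.last d) := by
  rw [last, List.ofFn_succ', List.concat_eq_append]
  simp

theorem init_ofFn (α : Fin (d + 1) → ℕ) :
    init (List.ofFn α) = List.ofFn fun i : Fin d => α i.castSucc := by
  rw [init, List.ofFn_succ', List.concat_eq_append]
  simp

theorem isCornerList_layer (hΔ : IsStandard Δ) {C : List (List ℕ)} (hC : IsCornerList Δ C)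
    (k : ℕ) : IsCornerList (layerSet Δ k) (layer C k) := by
  obtain ⟨A, rfl, hA, -⟩ := hC.exists_generates hΔ
  have : ((A.map List.ofFn).filter fun c => decide (last c ≤ k)).map (fun c => init c) =
      ((A.filter fun α => decide (α (Fin.last d) ≤ k)).map
        fun α i => α (Fin.castSucc i)).map List.ofFn := by
    rw [List.filter_map, List.map_map, List.map_map]
    simp only [Function.comp_def, last_ofFn, init_ofFn]
  rw [layer, this]
  refine isCornerList_minimals fun γ => ?_
  rw [mem_layerSet, hA]
  simp only [List.mem_map, List.mem_filter, decide_eq_true_eq, le_point_iff]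
  constructor
  · rintro ⟨a, ha, h1, h2⟩
    exact ⟨_, ⟨a, ⟨ha, h2⟩, rfl⟩, h1⟩
  · rintro ⟨-, ⟨a, ⟨ha, h2⟩, rfl⟩, h1⟩
    exact ⟨a, ha, h1, h2⟩

/-- Exactly one outer corner lies on the last axis: it exists because `Δ` is finite, and it is
unique because two such corners are comparable. Its last coordinate is the height over `0`. -/
theorem lt_numLayers_iff (hΔ : IsStandard Δ) {C : List (List ℕ)} (hC : IsCornerList Δ C) (j : ℕ) :
    j < numLayers C ↔ point 0 j ∈ Δ := by
  obtain ⟨A, rfl, hA, hA'⟩ := hC.exists_generates hΔ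
  have hz : ∀ α : Fin (d + 1) → ℕ, ((init (List.ofFn α)).all fun a => decide (a ≤ 0)) = true ↔
      α = point 0 (α (Fin.last d)) := by
    intro α
    rw [init_ofFn]
    simp only [List.all_eq_true, List.forall_mem_ofFn_iff, Nat.le_zero, decide_eq_true_eq]
    constructor
    · intro h
      rw [← point_eta α]
      congr 1
      · exact funext h
      · simp
    · intro h i
      rw [h, point_castSucc, Pi.zero_apply]
  have hfilter : ((A.map List.ofFn).filter fun c => (init c).all fun a => decide (a ≤ 0)).map
      (fun c => last c) = ((A.filter fun α => (init (List.ofFn α)).all fun a => decide (a ≤ 0)).map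
        fun α => α (Fin.last d)) := by
    rw [List.filter_map, List.map_map]
    simp only [Function.comp_def, last_ofFn]
  obtain ⟨n, hn⟩ : ∃ n, point (0 : Fin d → ℕ) n ∉ Δ := by
    by_contra! h
    refine Set.infinite_of_injective_forall_mem (s := (Δ : Set (Fin (d + 1) → ℕ)))
      (f := fun n => point (0 : Fin d → ℕ) n) (fun a b hab => ?_) h Δ.finite_toSet
    simpa using congrFun hab (Fin.last d)
  obtain ⟨α, hα, hαn⟩ := (hA _).1 hn
  have hα0 : α = point 0 (α (Fin.last d)) := by
    rw [le_point_iff] at hαn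
    conv_lhs => rw [← point_eta α]
    congr 1
    exact le_antisymm hαn.1 (Pi.le_def.2 fun _ => Nat.zero_le _)
  have huniq : ∀ β ∈ A, β = point 0 (β (Fin.last d)) → β (Fin.last d) = α (Fin.last d) := by
    intro β hβ hβ0
    have h1 := (hA' α).1 hα
    have h2 := (hA' β).1 hβ
    rcases le_total (β (Fin.last d)) (α (Fin.last d)) with h | h
    · have h3 : β ≤ α := by rw [hβ0, hα0, point_le_point]; simpa using h
      exact le_antisymm h (h1.2 h2.1 h3 _)
    · have h3 : α ≤ β := by rw [hβ0, hα0, point_le_point]; simpa using h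
      exact le_antisymm (h2.2 h1.1 h3 _) h
  have hnum : numLayers (A.map List.ofFn) = α (Fin.last d) := by
    rw [numLayers, hfilter]
    rcases hl : A.filter fun α => (init (List.ofFn α)).all fun a => decide (a ≤ 0) with _ | ⟨β, l⟩
    -- The default value in `numLayers` is never used, as the corner `α` survives the filter.
    · have : α ∈ A.filter fun α => (init (List.ofFn α)).all fun a => decide (a ≤ 0) :=
        List.mem_filter.2 ⟨hα, (hz α).2 hα0⟩
      rw [hl] at this
      exact absurd this List.not_mem_nil
    · have : β ∈ A.filter fun α => (init (List.ofFn α)).all fun a => decide (a ≤ 0) := by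
        rw [hl]
        exact List.mem_cons_self
      obtain ⟨hβ, hβ'⟩ := List.mem_filter.1 this
      exact huniq β hβ ((hz β).1 hβ')
  rw [hnum, ← not_iff_not, hA]
  constructor
  · intro h
    exact ⟨α, hα, by rw [hα0, point_le_point]; simpa using h⟩
  · rintro ⟨β, hβ, hβj⟩
    rw [le_point_iff] at hβj
    have hβ0 : β = point 0 (β (Fin.last d)) := by
      conv_lhs => rw [← point_eta β]
      congr 1
      exact le_antisymm hβj.1 (Pi.le_def.2 fun _ => Nat.zero_le _)
    rw [← huniq β hβ hβ0]
    exact not_lt.2 hβj.2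

/-- Layers are prepended from the top downwards, so the finished list starts with layer `0`. -/
theorem iterate_layerStep (C : List (List ℕ)) (n i : ℕ) (hi : i ≤ n) :
    layerStep^[i] (C, n, []) = (C, n - i, (List.range' (n - i) i).map (layer C)) := by
  induction i with
  | zero => rfl
  | succ i ih =>
    rw [Function.iterate_succ_apply', ih (by omega), layerStep]
    simp only [Nat.sub_sub, List.range'_succ, List.map_cons]
    rw [show n - (i + 1) + 1 = n - i by omega]

/-- As the states never shrink, it is enough to bound the final one. -/
theorem sz_layerStep (s : List (List ℕ) × ℕ × List (List (List ℕ))) : sz s ≤ sz (layerStep s) := by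
  simp [layerStep]

theorem represents_layers (hΔ : IsStandard Δ) {C : List (List ℕ)} (hC : IsCornerList Δ C) :
    Represents Δ ((List.range (numLayers C)).map (layer C)) ∧
      mden d ((List.range (numLayers C)).map (layer C)) =
        (List.range (numLayers C)).map (layerSet Δ) := by
  have hdec := isC4Decomposition_layerSet hΔ (lt_numLayers_iff hΔ hC)
  have hstd : ∀ k < numLayers C, IsStandard (layerSet Δ k) := fun k hk =>
    ((isC4Decomposition_iff.1 hdec).1 _ (Multiset.mem_coe.2
      (List.mem_map_of_mem (List.mem_range.2 hk)))).1
  have heq : mden d ((List.range (numLayers C)).map (layer C)) =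
      (List.range (numLayers C)).map (layerSet Δ) := by
    rw [mden, List.map_map]
    refine congrArg _ (List.map_congr_left fun k hk => ?_)
    exact den_eq (hstd k (List.mem_range.1 hk)) (isCornerList_layer hΔ hC k)
  refine ⟨⟨fun G hG => ?_, by rwa [heq]⟩, heq⟩
  obtain ⟨k, hk, rfl⟩ := List.mem_map.1 hG
  exact ⟨_, hstd k (List.mem_range.1 hk), isCornerList_layer hΔ hC k⟩

end correctness

/-! ### The program -/

/-- The code first sets up and runs the loop over the layers, then the search loop, then the report.
The height of `Δ` may be huge compared with the number of corners, but every round of the first loop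
adds a member to the decomposition into layers, which is itself part of the output. -/
theorem exists_code : ∃ (c : Code) (T : ℕ → ℕ), IsPoly T ∧
    ∀ (d : ℕ) (Δ : Finset (Fin (d + 1) → ℕ)), IsStandard Δ → ∀ C : List (List ℕ),
      IsCornerList Δ C → ∃ (y : List (List (List ℕ)) × List (List ℕ)) (t : ℕ),
        IsListOfC4Decompositions Δ y.1 y.2 ∧ c.Evals (enc C) (enc y) t ∧ t ≤ T (sz C + sz y) := by
  obtain ⟨c₁, T₁, hT₁, h₁⟩ := (by fun_prop :
    PT fun C : List (List ℕ) => (C, numLayers C, ([] : List (List (List ℕ)))))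
  obtain ⟨c₂, T₂, hT₂, h₂⟩ := PT.loop (c := fun s : List (List ℕ) × ℕ × List (List (List ℕ)) =>
    !decide (s.2.1 ≤ 0)) (by fun_prop) PT.layerStep
  obtain ⟨c₃, T₃, hT₃, h₃⟩ := (by fun_prop :
    PT fun s : List (List ℕ) × ℕ × List (List (List ℕ)) => [s.2.2])
  obtain ⟨c₄, T₄, hT₄, h₄⟩ := PT.loop PT.growing PT.grow
  obtain ⟨c₅, T₅, hT₅, h₅⟩ := PT.report
  let B : ℕ → ℕ := fun n => 1 + n * (1 + (1 + n * (1 + n)))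
  have hB : IsPoly B := by fun_prop
  -- `B` bounds the search list in terms of the output, `3 + n + B n` bounds a state of the layer
  -- loop, and the final `4` pays for the four compositions.
  refine ⟨c₁.comp (c₂.comp (c₃.comp (c₄.comp c₅))), fun n => T₁ n + (B n + 1) * T₂ (3 + n + B n) +
    T₃ (3 + n + B n) + (B n + 1) * T₄ (B n) + T₅ (B n) + 4, by fun_prop, ?_⟩
  intro d Δ hΔ C hC
  set n := numLayers C with hn
  set L₀ := (List.range n).map (layer C) with hL₀
  obtain ⟨hrep, hmden⟩ := represents_layers hΔ hC
  rw [← hn, ← hL₀] at hrep hmden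
  have hadm₀ : Admissible Δ [L₀] := ⟨by simpa using hrep, by simp⟩
  obtain ⟨m, hm, hm'⟩ := exists_not_growing hadm₀
  set S := grow^[m] [L₀] with hS
  have hadm : ∀ i, Admissible Δ (grow^[i] [L₀]) := by
    intro i
    induction i with
    | zero => exact hadm₀
    | succ i ih => rw [Function.iterate_succ_apply']; exact ih.grow
  have hsuff : ∀ i j, i ≤ j → grow^[i] [L₀] <:+ grow^[j] [L₀] := by
    intro i j hij
    induction j, hij using Nat.le_induction with
    | base => exact List.suffix_rfl
    | succ j _ ih =>
      rw [Function.iterate_succ_apply']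
      exact ih.trans (suffix_insertAll _ _ _)
  have hL₀S : L₀ ∈ S := (hsuff 0 m (Nat.zero_le _)).subset (by simp)
  -- Every round before the last adds at least one decomposition, so the number of rounds is bounded
  -- by the length of the final list.
  have hmS : m ≤ S.length := by
    have : ∀ i ≤ m, i ≤ (grow^[i] [L₀]).length := by
      intro i hi
      induction i with
      | zero => simp
      | succ i ih =>
        have h6 := hm i (by omega)
        have h7 := ih (by omega)
        simp only [growing, Bool.not_eq_true', decide_eq_false_iff_not] at h6
        rw [Function.iterate_succ_apply']
        omega
    exact this m le_rfl
  have hcomplete : ∀ M : Multiset (Finset (Fin d → ℕ)), IsC4Decomposition Δ M →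
      ∃ L ∈ S, mden d L = M := fun M hM =>
    (hadm m).complete hm' (lt_numLayers_iff hΔ hC) hL₀S hmden hM
  have hbound : sz S ≤ B (sz (report S)) := sz_le_sz_report (hadm m)
  have hbound' : sz S ≤ B (sz C + sz (report S)) := hbound.trans (hB.monotone (by omega))
  have hfinal : layerStep^[n] (C, n, []) = (C, 0, L₀) := by
    rw [iterate_layerStep C n n le_rfl, Nat.sub_self, ← List.range_eq_range']
  have hmono : Monotone fun i => sz (layerStep^[i] (C, n, [])) :=
    monotone_nat_of_le_succ fun i => by
      rw [Function.iterate_succ_apply']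
      exact sz_layerStep _
  have hL₀sz : sz L₀ ≤ sz S := sz_mem hL₀S
  have hstate : sz (C, 0, L₀) ≤ 3 + (sz C + sz (report S)) + B (sz C + sz (report S)) := by
    have : sz (C, 0, L₀) = 1 + sz C + (1 + 1 + sz L₀) := rfl
    omega
  obtain ⟨-, t₁, ht₁, e₁⟩ := h₁ C
  obtain ⟨t₂, ht₂, e₂⟩ := h₂ (C, n, []) n _ (fun i hi => by
      rw [iterate_layerStep C n i hi.le]
      simpa using by omega) (by rw [hfinal]; simp) fun i hi => by
    have := hmono hi
    simp only [hfinal] at this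
    exact this.trans hstate
  rw [hfinal] at e₂
  obtain ⟨-, t₃, ht₃, e₃⟩ := h₃ (C, 0, L₀)
  obtain ⟨t₄, ht₄, e₄⟩ := h₄ [L₀] m _ hm hm' fun i hi =>
    (sz_sublist (hsuff i m hi).sublist).trans hbound'
  obtain ⟨-, t₅, ht₅, e₅⟩ := h₅ S
  refine ⟨report S, _, isListOfC4Decompositions_report (hadm m) hcomplete,
    e₁.comp (e₂.comp (e₃.comp (e₄.comp e₅))), ?_⟩
  have k₁ := hT₁.monotone (Nat.le_add_right (sz C) (sz (report S)))
  have k₃ := hT₃.monotone hstate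
  have k₅ := hT₅.monotone hbound'
  have k₂ : n + 1 ≤ B (sz C + sz (report S)) + 1 := by
    have : n = L₀.length := by simp [hL₀]
    have := length_le_sz L₀
    omega
  have k₄ : m + 1 ≤ B (sz C + sz (report S)) + 1 := by
    have := length_le_sz S
    omega
  have k₂' := ht₂.trans (Nat.mul_le_mul_right _ k₂)
  have k₄' := ht₄.trans (Nat.mul_le_mul_right _ k₄)
  beta_reduce
  omega

end ConnectFour

theorem mainTheorem3 :
    ∃ (P : ConnectFour.Program) (p : Polynomial ℕ),
      ∀ (d : ℕ) (Δ : Finset (Fin (d + 1) → ℕ)), ConnectFour.IsStandard Δ →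
        ∀ C : List (List ℕ), ConnectFour.IsCornerList Δ C →
          ∃ (S : List (List (List ℕ))) (D : List (List ℕ)) (t : ℕ),
            ConnectFour.IsListOfC4Decompositions Δ S D ∧
            P.Computes (ConnectFour.encodeInput C) (ConnectFour.encodeOutput S D) t ∧
            t ≤ p.eval ((ConnectFour.encodeInput C).size +
              (ConnectFour.encodeOutput S D).size) := by
  obtain ⟨c, T, ⟨p, hp⟩, h⟩ := ConnectFour.exists_code
  -- The main expression occupies position `0`, so the functions it calls start at position `1`.
  refine ⟨c.expr 1 :: c.blk 1, p, fun d Δ hΔ C hC => ?_⟩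
  obtain ⟨y, t, hy, he, ht⟩ := h d Δ hΔ C hC
  refine ⟨y.1, y.2, t, hy, ⟨_, rfl, he _ 1 [] fun i e hi => ?_⟩, ?_⟩
  · rw [Nat.add_comm]
    exact hi
  · rw [← hp]
    exact ht
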